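/- Let $m\ge 1$, $n\ge1$ and let $\mathbb K$ be $\mathbb R$ or $\mathbb C$. Let $A_1,\dots,A_m$ be symmetric (if $\mathbb K=\mathbb R$) or hermitian (if $\mathbb K=\mathbb C$) $n\times n$ matrices over $\mathbb K$, let $v_1,\dots,v_m\in\mathbb K^n$, and let $f:\mathbb K^n\to\mathbb R^m$ be the quadratic map with components $$f_i(x)=x^*A_ix-v_i^*x-x^*v_i ,\qquad i=1,\dots,m .$$ The inhomogeneous joint numerical range is $\mathcal F(A,v)=\{f(x): x\in\mathbb K^n,\ |x|=1\}\subset\mathbb R^m$. For $c\in\mathbb R^m$ write $c\cdot A=\sum_i c_iA_i$ and $c\cdot v=\sum_i c_iv_i$, and let $\lambda_{\min}(M)$ denote the smallest eigenvalue of $M$. All norms are Euclidean, and a number added to a matrix stands for that multiple of the identity. Suppose that $$\lim_{\epsilon\to0^+}\ \min_{c\in\mathbb R^m,\ |c|=1}\ \left|\left(c\cdot A-\lambda_{\min}(c\cdot A)+\epsilon\right)^{-1}c\cdot v\right|>1,$$ where the limit is taken in $[0,+\infty]$. (i) If $n>m$ in the case $\mathbb K=\mathbb R$, or $2n>m$ in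 the case $\mathbb K=\mathbb C$, then $\mathcal F(A,v)$ is strongly convex and smooth. Strongly convex means: there is $\kappa>0$ such that for all $x,y\in\mathcal F(A,v)$ and all $a,b\ge0$ with $a+b=1$ the closed ball with centre $ax+by$ and radius $\kappa ab|x-y|^2$ is contained in $\mathcal F(A,v)$. Smooth means: each boundary point $p$ of $\mathcal F(A,v)$ has an open neighbourhood $U$ with a $C^\infty$ function $g:U\to\mathbb R$ such that $dg(p)\ne0$ and $\mathcal F(A,v)\cap U=\{y\in U: g(y)\le0\}$. (ii) If $n=m$ in the case $\mathbb K=\mathbb R$, or $2n=m$ in the case $\mathbb K=\mathbb C$, then $\mathcal F(A,v)$ is an "empty shell", $\mathcal F(A,v)=\partial\,\mathrm{Conv}[\mathcal F(A,v)]$, where $\mathrm{Conv}$ denotes the convex hull. -/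

import Mathlib

open Filter Topology
open scoped ContDiff

noncomputable section

namespace QuadMap

variable {𝕜 : Type*} [RCLike 𝕜] {m n : ℕ}

/-- The quadratic map `f : 𝕜ⁿ → ℝᵐ` with components `f_i(x) = x* A_i x - v_i* x - x* v_i`, where `𝕜` is
`ℝ` or `ℂ`. Mathlib's `inner 𝕜 x y` is `x* y`. For Hermitian `A_i` the expression under `RCLike.re`
is real, so that `RCLike.re` only changes the type. -/
def quadMap (A : Fin m → Matrix (Fin n) (Fin n) 𝕜) (v : Fin m → EuclideanSpace 𝕜 (Fin n))
    (x : EuclideanSpace 𝕜 (Fin n)) : EuclideanSpace ℝ (Fin m) :=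
  WithLp.toLp 2 fun i =>
    RCLike.re (inner 𝕜 x (Matrix.toEuclideanLin (A i) x) - inner 𝕜 (v i) x - inner 𝕜 x (v i))

/-- The inhomogeneous joint numerical range `F(A, v) = {f(x) : |x| = 1}`. -/
def jointNumRange (A : Fin m → Matrix (Fin n) (Fin n) 𝕜)
    (v : Fin m → EuclideanSpace 𝕜 (Fin n)) : Set (EuclideanSpace ℝ (Fin m)) :=
  quadMap A v '' Metric.sphere 0 1

/-- The smallest (real) eigenvalue of a Hermitian matrix. -/
def lambdaMin (M : Matrix (Fin n) (Fin n) 𝕜) : ℝ :=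
  sInf {μ : ℝ | ∃ x : Fin n → 𝕜, x ≠ 0 ∧ M.mulVec x = μ • x}

/-- The matrix `c · A = ∑ c_i A_i`. -/
def dotMat (c : EuclideanSpace ℝ (Fin m)) (A : Fin m → Matrix (Fin n) (Fin n) 𝕜) :
    Matrix (Fin n) (Fin n) 𝕜 :=
  ∑ i, c i • A i

/-- The vector `c · v = ∑ c_i v_i`. -/
def dotVec (c : EuclideanSpace ℝ (Fin m)) (v : Fin m → EuclideanSpace 𝕜 (Fin n)) :
    EuclideanSpace 𝕜 (Fin n) :=
  ∑ i, c i • v i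

/-- The number `|(c·A - λ_min(c·A) + ε)⁻¹ (c·v)|`, with the Euclidean norm. For Hermitian `A_i` and
`ε > 0` the matrix is positive definite, hence invertible. -/
def resolventNorm (A : Fin m → Matrix (Fin n) (Fin n) 𝕜) (v : Fin m → EuclideanSpace 𝕜 (Fin n))
    (ε : ℝ) (c : EuclideanSpace ℝ (Fin m)) : ℝ :=
  ‖Matrix.toEuclideanLin
      (dotMat c A - lambdaMin (dotMat c A) • (1 : Matrix (Fin n) (Fin n) 𝕜)
        + ε • (1 : Matrix (Fin n) (Fin n) 𝕜))⁻¹ (dotVec c v)‖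

/-- The minimum of `|(c·A - λ_min(c·A) + ε)⁻¹ (c·v)|` over the unit sphere of `ℝᵐ`; for `m ≥ 1`,
Hermitian `A_i` and `ε > 0` it is the minimum of a continuous function on a nonempty compact set. -/
def minResolventNorm (A : Fin m → Matrix (Fin n) (Fin n) 𝕜)
    (v : Fin m → EuclideanSpace 𝕜 (Fin n)) (ε : ℝ) : ℝ :=
  sInf (resolventNorm A v ε '' Metric.sphere 0 1)

/-- Strong convexity of a set: for some `κ > 0`, around each point `a x + b y` of a segment with end
points in `S` the closed ball of radius `κ a b |x - y|²` lies in `S`. -/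
def StronglyConvexSet (S : Set (EuclideanSpace ℝ (Fin m))) : Prop :=
  ∃ κ : ℝ, 0 < κ ∧ ∀ x ∈ S, ∀ y ∈ S, ∀ a b : ℝ, 0 ≤ a → 0 ≤ b → a + b = 1 →
    Metric.closedBall (a • x + b • y) (κ * a * b * ‖x - y‖ ^ 2) ⊆ S

/-- Smoothness of a set (with nonempty interior): its boundary is a `C^∞` hypersurface with the set on
one side of it, that is, near each boundary point `S` is `{g ≤ 0}` for a `C^∞` function `g` whose
derivative does not vanish at that point. -/
def HasSmoothBoundary (S : Set (EuclideanSpace ℝ (Fin m))) : Prop :=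
  ∀ p ∈ frontier S, ∃ U : Set (EuclideanSpace ℝ (Fin m)), IsOpen U ∧ p ∈ U ∧
    ∃ g : EuclideanSpace ℝ (Fin m) → ℝ, ContDiffOn ℝ ∞ g U ∧ fderiv ℝ g p ≠ 0 ∧
      ∀ y ∈ U, y ∈ S ↔ g y ≤ 0

end QuadMap

end

/-! ### Zeros of outward-pointing vector fields on the unit ball. -/

section VectorFieldZero

open MeasureTheory Metric Set Polynomial
open scoped RealInnerProductSpace

variable {E : Type*} [NormedAddCommGroup E] [InnerProductSpace ℝ E]

/-! Regard `𝕜ⁿ` as a real inner product space `E`, put `V = ℝᵐ`, and write `⟪c, f x⟫ = ⟪A c x, x⟫ -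
2 ⟪v c, x⟫`. A minimizer `x` of this function on the unit sphere satisfies `A c x + μ x = v c` with
`A c + μ ≥ 0`. The norm of `(c·A - λ_min + t)⁻¹ (c·v)` does not increase with `t` and is eventually
at most 1. If it exceeds 1 at one `ε > 0` for all unit `c`, then a unit solution exists, and every
minimizer has `A c + μ ≥ ε` (`IsGapped.exists_of_resolvent`). This uniform gap is all that is used
afterwards.

On the sphere, `⟪c, f p - f x⟫` equals the form `A c + μ` evaluated at `p - x`. With the gap this
makes the minimizer `X c` unique and continuous in `c`, and it puts the image inside a ball of fixed
radius touching it at `f (X c)`. Moreover, a point that is a minimizer for `c` satisfies the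
Lagrange equation only for multiples of `c` (`IsGapped.eq_inner_smul_of_isSphereMin`).

If `dim E > dim V`, some nonzero `w` is orthogonal to the range of `v`, and it serves to extend `X`
to a continuous map from the ball of `V` to the sphere of `E`. For `y` strictly inside all
supporting half-spaces, `y` minus the composite of `f` with this map is an outward field on the
ball; its zero shows that `y` is attained (`IsGapped.mem_image_of_forall_inner_lt`). So the image is
the intersection of its supporting half-spaces, and the touching balls give strong convexity.
Smoothness follows from the inverse function theorem applied to the Lagrange system
(`IsGapped.fderiv_boundaryChart_injective`).

If `dim E = dim V`, a dimension count gives each unit vector a Lagrange direction, and connectedness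
of the sphere shows that each one is a minimizer (`IsGapped.sphere_subset_image_min`). Hence every
image point lies on the boundary of the hull. -/

/-- A function which is Lipschitz on the closed unit ball and vanishes on the unit sphere stays
Lipschitz when it is extended by zero. -/
theorem LipschitzOnWith.indicator_closedBall {g : E → E} {C : NNReal}
    (hg : LipschitzOnWith C g (closedBall 0 1)) (h0 : ∀ x ∈ sphere (0 : E) 1, g x = 0) :
    LipschitzWith C ((closedBall (0 : E) 1).indicator g) := by
  have key : ∀ x ∈ closedBall (0 : E) 1, ∀ y ∉ closedBall (0 : E) 1, ‖g x‖ ≤ C * ‖x - y‖ := by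
    intro x hx y hy
    have hx' : ‖x‖ ≤ 1 := by simpa using hx
    have hy' : 1 < ‖y‖ := by simpa using hy
    -- The segment from `x` to `y` meets the sphere at some `z`, where `g` vanishes and which is no
    -- farther from `x` than `y` is.
    have hc : ContinuousOn (fun t : ℝ => ‖x + t • (y - x)‖) (Icc 0 1) := by fun_prop
    obtain ⟨t, ht, ht1⟩ := intermediate_value_Icc zero_le_one hc
      (show (1 : ℝ) ∈ Icc _ _ by constructor <;> simp [hx', hy'.le])
    set z := x + t • (y - x) with hz
    have hz1 : z ∈ sphere (0 : E) 1 := by simpa using ht1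
    have h1 := hg.dist_le_mul x hx z (sphere_subset_closedBall hz1)
    rw [h0 z hz1, dist_zero_right, dist_eq_norm] at h1
    refine h1.trans (mul_le_mul_of_nonneg_left ?_ C.2)
    have : x - z = t • (x - y) := by rw [hz]; module
    rw [this, norm_smul, Real.norm_eq_abs, abs_of_nonneg ht.1]
    exact mul_le_of_le_one_left (norm_nonneg _) ht.2
  refine LipschitzWith.of_dist_le_mul fun x y => ?_
  by_cases hx : x ∈ closedBall (0 : E) 1 <;> by_cases hy : y ∈ closedBall (0 : E) 1
  · rw [indicator_of_mem hx, indicator_of_mem hy]; exact hg.dist_le_mul x hx y hy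
  · rw [indicator_of_mem hx, indicator_of_notMem hy, dist_zero_right, dist_eq_norm]
    exact key x hx y hy
  · rw [indicator_of_notMem hx, indicator_of_mem hy, dist_zero_left, dist_comm, dist_eq_norm]
    exact key y hy x hx
  · rw [indicator_of_notMem hx, indicator_of_notMem hy, dist_self]; positivity

variable [FiniteDimensional ℝ E]

/-- The degree bound lets information about small `t` determine the value at `t = 1`. -/
theorem exists_polynomial_eval_eq_det_id_add_smul (M : E →L[ℝ] E) :
    ∃ p : ℝ[X], p.natDegree ≤ Module.finrank ℝ E ∧
      ∀ t : ℝ, p.eval t = (ContinuousLinearMap.id ℝ E + t • M).det := by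
  classical
  let b := Module.finBasis ℝ E
  let B := LinearMap.toMatrix b b (M : E →ₗ[ℝ] E)
  refine ⟨((X : ℝ[X]) • B.map C + (1 : Matrix _ _ ℝ).map C).det, ?_, fun t => ?_⟩
  · simpa using natDegree_det_X_add_C_le B 1
  · rw [ContinuousLinearMap.det, ← LinearMap.det_toMatrix b]
    rw [← coe_evalRingHom, RingHom.map_det]
    congr 1
    ext i j
    simp [B, LinearMap.toMatrix_apply, Matrix.one_apply, Finsupp.single_apply, eq_comm, add_comm]
    split_ifs <;> simp [mul_comm]

/-- Along the segment from the identity the operator stays injective, so its determinant cannot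
change sign. -/
theorem ContinuousLinearMap.det_id_add_pos_of_norm_lt_one (M : E →L[ℝ] E) (hM : ‖M‖ < 1) :
    0 < (ContinuousLinearMap.id ℝ E + M).det := by
  have hne : ∀ s ∈ Icc (0 : ℝ) 1, (ContinuousLinearMap.id ℝ E + s • M).det ≠ 0 := by
    intro s hs h0
    have h1 : LinearMap.ker ((ContinuousLinearMap.id ℝ E + s • M : E →L[ℝ] E) : E →ₗ[ℝ] E) ≠ ⊥ :=
      (LinearMap.bot_lt_ker_of_det_eq_zero h0).ne'
    obtain ⟨z, hz, hz0⟩ := (Submodule.ne_bot_iff _).1 h1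
    have h2 : z = -(s • M z) := by
      have : z + s • M z = 0 := by simpa using hz
      exact eq_neg_of_add_eq_zero_left this
    have h3 : ‖z‖ ≤ ‖M‖ * ‖z‖ := by
      calc ‖z‖ = |s| * ‖M z‖ := by
            conv_lhs => rw [h2]
            rw [norm_neg, norm_smul, Real.norm_eq_abs]
        _ ≤ 1 * (‖M‖ * ‖z‖) := by
            gcongr
            · exact abs_le.2 ⟨by linarith [hs.1], hs.2⟩
            · exact M.le_opNorm z
        _ = _ := one_mul _
    have h4 : 0 < ‖z‖ := norm_pos_iff.2 hz0
    nlinarith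
  have hcont : ContinuousOn (fun s : ℝ => (ContinuousLinearMap.id ℝ E + s • M).det) (Icc 0 1) :=
    (ContinuousLinearMap.continuous_det.comp (by fun_prop)).continuousOn
  by_contra! hcon
  have h01 : (0 : ℝ) ∈ Icc ((fun s : ℝ => (ContinuousLinearMap.id ℝ E + s • M).det) 1)
      ((fun s : ℝ => (ContinuousLinearMap.id ℝ E + s • M).det) 0) := by
    constructor
    · simpa using hcon
    · simp [ContinuousLinearMap.det]
  obtain ⟨s, hs, hs0⟩ := intermediate_value_Icc' zero_le_one hcont h01
  exact hne s hs hs0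

/-- The analytic core of the no-retraction theorem (Milnor, Rogers): a `C¹` perturbation of the
identity that is trivial on the unit sphere is somewhere nonsingular in the unit ball. -/
theorem exists_det_id_add_fderiv_ne_zero [Nontrivial E] {g : E → E} {U : Set E} (hU : IsOpen U)
    (hBU : closedBall (0 : E) 1 ⊆ U) (hg : ContDiffOn ℝ 1 g U)
    (h0 : ∀ x ∈ sphere (0 : E) 1, g x = 0) :
    ∃ x ∈ ball (0 : E) 1, (ContinuousLinearMap.id ℝ E + fderiv ℝ g x).det ≠ 0 := by
  classical
  by_contra! hdet
  let _ : MeasurableSpace E := borel E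
  have : BorelSpace E := ⟨rfl⟩
  let μ : Measure E := Measure.addHaar
  have hDc : ContinuousOn (fderiv ℝ g) (closedBall 0 1) :=
    (hg.continuousOn_fderiv_of_isOpen hU le_rfl).mono hBU
  have hD : ∀ x ∈ closedBall (0 : E) 1, HasFDerivAt g (fderiv ℝ g x) x := fun x hx =>
    ((hg.differentiableOn one_ne_zero).differentiableAt (hU.mem_nhds (hBU hx))).hasFDerivAt
  obtain ⟨C₀, hC₀⟩ := (isCompact_closedBall (0 : E) 1).exists_bound_of_continuousOn hDc
  set C : NNReal := ⟨|C₀|, abs_nonneg _⟩ with hC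
  have hCb : ∀ x ∈ closedBall (0 : E) 1, ‖fderiv ℝ g x‖ ≤ C := fun x hx =>
    (hC₀ x hx).trans (le_abs_self _)
  have hlip : LipschitzOnWith C g (closedBall 0 1) :=
    (convex_closedBall (0 : E) 1).lipschitzOnWith_of_nnnorm_fderiv_le
      (fun x hx => (hD x hx).differentiableAt) (fun x hx => by exact_mod_cast hCb x hx)
  have hLip := hlip.indicator_closedBall h0
  set G := (closedBall (0 : E) 1).indicator g with hG
  have hGout : ∀ x, 1 ≤ ‖x‖ → G x = 0 := by
    intro x hx
    by_cases h : x ∈ closedBall (0 : E) 1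
    · rw [hG, indicator_of_mem h]
      exact h0 x (by simpa using le_antisymm (by simpa using h) hx)
    · rw [hG, indicator_of_notMem h]
  set t₀ : ℝ := 1 / (C + 1) with ht₀
  have hCp : (0 : ℝ) < C + 1 := by positivity
  have ht₀p : 0 < t₀ := by positivity
  have ht₀C : ∀ t, 0 ≤ t → t ≤ t₀ → t * C < 1 := by
    intro t _ htt
    calc t * C ≤ t₀ * C := by gcongr
      _ < 1 := by rw [ht₀, one_div, inv_mul_lt_iff₀ hCp]; linarith
  -- After extension by zero, `t • G` is a contraction, so identity plus `t • G` is a bijection of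
  -- `E`. It fixes every point outside the open ball and hence permutes the ball.
  have himage : ∀ t, 0 ≤ t → t ≤ t₀ →
      InjOn (fun x => x + t • g x) (ball (0 : E) 1) ∧
        (fun x => x + t • g x) '' ball (0 : E) 1 = ball 0 1 := by
    intro t ht htt
    have happ : ApproximatesLinearOn (fun x => x + t • G x)
        ((ContinuousLinearEquiv.refl ℝ E : E ≃L[ℝ] E) : E →L[ℝ] E) univ (t.toNNReal * C) := by
      intro x _ y _
      have h1 := hLip.dist_le_mul x y
      rw [dist_eq_norm, dist_eq_norm] at h1
      have h2 : x + t • G x - (y + t • G y) -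
          ((ContinuousLinearEquiv.refl ℝ E : E ≃L[ℝ] E) : E →L[ℝ] E) (x - y)
          = t • (G x - G y) := by
        simp only [ContinuousLinearEquiv.coe_coe, ContinuousLinearEquiv.refl_apply]
        module
      rw [h2, norm_smul, Real.norm_eq_abs, abs_of_nonneg ht]
      calc t * ‖G x - G y‖ ≤ t * (C * ‖x - y‖) := by gcongr
        _ = _ := by rw [NNReal.coe_mul, Real.coe_toNNReal t ht, mul_assoc]
    have hc : Subsingleton E ∨ (t.toNNReal * C : NNReal) <
        ‖((ContinuousLinearEquiv.refl ℝ E).symm : E →L[ℝ] E)‖₊⁻¹ := by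
      right
      have : ‖((ContinuousLinearEquiv.refl ℝ E).symm : E →L[ℝ] E)‖₊ = 1 := by
        rw [← NNReal.coe_inj]
        exact ContinuousLinearMap.norm_id (𝕜 := ℝ) (E := E)
      rw [this, inv_one, ← NNReal.coe_lt_coe]
      rw [NNReal.coe_mul, Real.coe_toNNReal t ht]
      exact ht₀C t ht htt
    have hinj : InjOn (fun x => x + t • G x) univ := happ.injOn hc
    have hsurj := happ.surjective hc
    have hEq : EqOn (fun x => x + t • g x) (fun x => x + t • G x) (ball (0 : E) 1) := by
      intro x hx
      simp [hG, indicator_of_mem (ball_subset_closedBall hx)]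
    refine ⟨(hinj.mono (subset_univ _)).congr hEq.symm, ?_⟩
    rw [hEq.image_eq]
    apply Subset.antisymm
    · rintro _ ⟨x, hx, rfl⟩
      by_contra hz
      have hz' : 1 ≤ ‖x + t • G x‖ := by simpa using hz
      have := hinj (mem_univ (x + t • G x)) (mem_univ x) (by simp [hGout _ hz'])
      rw [this] at hz'
      have hx' : ‖x‖ < 1 := by simpa using hx
      linarith
    · intro y hy
      obtain ⟨x, hx⟩ := hsurj y
      refine ⟨x, ?_, hx⟩
      by_contra hz
      have hz' : 1 ≤ ‖x‖ := by simpa using hz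
      have : x = y := by simpa [hGout _ hz'] using hx
      exact hz (this ▸ hy)
  have hint : ∀ t : ℝ, IntegrableOn
      (fun x => (ContinuousLinearMap.id ℝ E + t • fderiv ℝ g x).det) (ball 0 1) μ := by
    intro t
    refine IntegrableOn.mono_set ?_ ball_subset_closedBall
    refine ContinuousOn.integrableOn_compact (isCompact_closedBall _ _) ?_
    exact ContinuousLinearMap.continuous_det.comp_continuousOn (by fun_prop)
  have hvol : ∀ t, 0 ≤ t → t ≤ t₀ →
      ∫ x in ball (0 : E) 1, (ContinuousLinearMap.id ℝ E + t • fderiv ℝ g x).det ∂μ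
        = μ.real (ball 0 1) := by
    intro t ht htt
    obtain ⟨hinj, him⟩ := himage t ht htt
    have h1 := integral_image_eq_integral_abs_det_fderiv_smul μ measurableSet_ball
      (f := fun x => x + t • g x) (f' := fun x => ContinuousLinearMap.id ℝ E + t • fderiv ℝ g x)
      (fun x hx => ((hasFDerivAt_id x).add
        ((hD x (ball_subset_closedBall hx)).const_smul t)).hasFDerivWithinAt) hinj
      (fun _ => (1 : ℝ))
    rw [him] at h1
    simp only [smul_eq_mul, mul_one, integral_const, MeasurableSet.univ, measureReal_restrict_apply,
      univ_inter] at h1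
    rw [h1]
    refine setIntegral_congr_fun measurableSet_ball fun x hx => ?_
    refine (abs_of_pos ?_).symm
    apply ContinuousLinearMap.det_id_add_pos_of_norm_lt_one
    rw [norm_smul, Real.norm_eq_abs, abs_of_nonneg ht]
    exact (mul_le_mul_of_nonneg_left (hCb x (ball_subset_closedBall hx)) ht).trans_lt
      (ht₀C t ht htt)
  set d := Module.finrank ℝ E with hd
  set node : ℕ → ℝ := fun j => t₀ * (j / (d + 1)) with hnode
  have hnode_inj : InjOn node (Finset.range (d + 1) : Set ℕ) := by
    intro i _ j _ hij
    have hd1 : (d : ℝ) + 1 ≠ 0 := by positivity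
    have := mul_left_cancel₀ ht₀p.ne' hij
    field_simp at this
    exact_mod_cast this
  have hnode0 : ∀ j, 0 ≤ node j := fun j => by positivity
  have hnode1 : ∀ j ∈ Finset.range (d + 1), node j ≤ t₀ := by
    intro j hj
    have : (j : ℝ) ≤ d + 1 := by exact_mod_cast (Finset.mem_range.1 hj).le
    exact mul_le_of_le_one_right ht₀p.le (div_le_one_of_le₀ this (by positivity))
  -- Interpolation weights with `∑ w j * p (node j) = p 1` for every `p` of degree at most `d`. All
  -- nodes lie in `[0, t₀]`, where the integrated determinant is the volume of the ball, while at 1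
  -- the determinant vanishes by assumption. Hence the volume would be zero.
  set w : ℕ → ℝ := fun j => (Lagrange.basis (Finset.range (d + 1)) node j).eval 1 with hw
  have hwsum : ∑ j ∈ Finset.range (d + 1), w j = 1 := by
    rw [hw, ← eval_finsetSum, Lagrange.sum_basis hnode_inj ⟨0, by simp⟩, eval_one]
  have hpt : ∀ x ∈ ball (0 : E) 1, ∑ j ∈ Finset.range (d + 1),
      w j * (ContinuousLinearMap.id ℝ E + node j • fderiv ℝ g x).det = 0 := by
    intro x hx
    obtain ⟨p, hp, hpe⟩ := exists_polynomial_eval_eq_det_id_add_smul (fderiv ℝ g x)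
    have h1 : p = Lagrange.interpolate (Finset.range (d + 1)) node (fun j => p.eval (node j)) := by
      refine Lagrange.eq_interpolate_of_eval_eq _ hnode_inj ?_ fun _ _ => rfl
      rw [Finset.card_range]
      exact lt_of_le_of_lt degree_le_natDegree (by exact_mod_cast Nat.lt_succ_of_le hp)
    have h2 : p.eval 1 = 0 := by rw [hpe, one_smul]; exact hdet x hx
    rw [h1, Lagrange.interpolate_apply, eval_finsetSum] at h2
    rw [← h2]
    refine Finset.sum_congr rfl fun j _ => ?_
    rw [eval_mul, eval_C, hpe, mul_comm]
  have hfin : ∑ j ∈ Finset.range (d + 1), w j * μ.real (ball (0 : E) 1) = 0 := by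
    calc ∑ j ∈ Finset.range (d + 1), w j * μ.real (ball (0 : E) 1)
        = ∑ j ∈ Finset.range (d + 1), ∫ x in ball (0 : E) 1,
            w j * (ContinuousLinearMap.id ℝ E + node j • fderiv ℝ g x).det ∂μ := by
          refine Finset.sum_congr rfl fun j hj => ?_
          rw [integral_const_mul, hvol _ (hnode0 j) (hnode1 j hj)]
      _ = ∫ x in ball (0 : E) 1, ∑ j ∈ Finset.range (d + 1),
            w j * (ContinuousLinearMap.id ℝ E + node j • fderiv ℝ g x).det ∂μ :=
          (integral_finsetSum _ fun j _ => (hint _).const_mul _).symm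
      _ = ∫ x in ball (0 : E) 1, (0 : ℝ) ∂μ := setIntegral_congr_fun measurableSet_ball hpt
      _ = 0 := by simp
  rw [← Finset.sum_mul, hwsum, one_mul] at hfin
  have hpos : 0 < μ (ball (0 : E) 1) := measure_ball_pos μ 0 one_pos
  have hlt : μ (ball (0 : E) 1) < ⊤ := measure_ball_lt_top
  exact (ENNReal.toReal_pos hpos.ne' hlt.ne).ne' hfin

/-- A `C¹` vector field which points outwards on the unit sphere vanishes in the unit ball. -/
theorem exists_eq_zero_of_contDiff_of_outward [Nontrivial E] {φ : E → E} (hφ : ContDiff ℝ 1 φ)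
    (hout : ∀ x ∈ sphere (0 : E) 1, 0 < ⟪x, φ x⟫) :
    ∃ x ∈ closedBall (0 : E) 1, φ x = 0 := by
  by_contra! hne
  set b : E → ℝ := fun x => ⟪x, φ x⟫ with hb
  -- Without a zero, moving from `x` along `φ x` to the sphere is a retraction. The travel time `τ`
  -- is the larger root of `‖φ x‖² τ² + 2 b τ + ‖x‖² - 1`, and `D` is a quarter of its discriminant.
  -- On the sphere `b > 0`, so that `τ = 0` there.
  set D : E → ℝ := fun x => b x ^ 2 + ‖φ x‖ ^ 2 * (1 - ‖x‖ ^ 2) with hD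
  set τ : E → ℝ := fun x => (-b x + √(D x)) / ‖φ x‖ ^ 2 with hτ
  set g : E → E := fun x => τ x • φ x with hg
  set U : Set E := {x | φ x ≠ 0} ∩ {x | 0 < D x} with hU
  have hbc : ContDiff ℝ 1 b := contDiff_id.inner ℝ hφ
  have hDc : ContDiff ℝ 1 D := (hbc.pow 2).add ((hφ.norm_sq ℝ).mul
    (contDiff_const.sub (contDiff_id.norm_sq ℝ)))
  have hUo : IsOpen U := (isOpen_ne_fun hφ.continuous continuous_const).inter
    (isOpen_lt continuous_const hDc.continuous)
  have hφpos : ∀ x ∈ closedBall (0 : E) 1, 0 < ‖φ x‖ ^ 2 := fun x hx =>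
    pow_pos (norm_pos_iff.2 (hne x hx)) 2
  have hBU : closedBall (0 : E) 1 ⊆ U := by
    intro x hx
    refine ⟨hne x hx, ?_⟩
    have hx1 : ‖x‖ ≤ 1 := by simpa using hx
    have h1 := hφpos x hx
    change 0 < b x ^ 2 + ‖φ x‖ ^ 2 * (1 - ‖x‖ ^ 2)
    rcases hx1.eq_or_lt with h | h
    · have := hout x (by simpa using h)
      have h2 : 0 < b x ^ 2 := pow_pos this 2
      rw [h]; linarith
    · have h3 : 0 < 1 - ‖x‖ ^ 2 := by nlinarith [norm_nonneg x]
      have h4 : 0 < ‖φ x‖ ^ 2 * (1 - ‖x‖ ^ 2) := mul_pos h1 h3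
      have h5 := sq_nonneg (b x)
      linarith
  have hgU : ContDiffOn ℝ 1 g U := by
    refine ContDiffOn.smul (ContDiffOn.div ?_ (hφ.norm_sq ℝ).contDiffOn ?_) hφ.contDiffOn
    · exact hbc.neg.contDiffOn.add (hDc.contDiffOn.sqrt fun x hx => hx.2.ne')
    · exact fun x hx => pow_ne_zero 2 (norm_ne_zero_iff.2 hx.1)
  have hg0 : ∀ x ∈ sphere (0 : E) 1, g x = 0 := by
    intro x hx
    have hx1 : ‖x‖ = 1 := by simpa using hx
    have h1 : D x = b x ^ 2 := by simp [hD, hx1]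
    have h2 : τ x = 0 := by
      have hbx : 0 < b x := hout x hx
      simp only [hτ, h1, Real.sqrt_sq hbx.le, neg_add_cancel, zero_div]
    simp [hg, h2]
  have hnorm : ∀ x ∈ U, ‖x + g x‖ ^ 2 = 1 := by
    intro x hx
    have h1 : ‖φ x‖ ^ 2 ≠ 0 := pow_ne_zero 2 (norm_ne_zero_iff.2 hx.1)
    have h2 : √(D x) ^ 2 = D x := Real.sq_sqrt (le_of_lt hx.2)
    have h3 : ‖φ x‖ ^ 2 * τ x = -b x + √(D x) := mul_div_cancel₀ _ h1
    have h4 : ‖x + g x‖ ^ 2 = ‖x‖ ^ 2 + 2 * τ x * b x + τ x ^ 2 * ‖φ x‖ ^ 2 := by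
      rw [norm_add_sq_real, hg]
      simp only [inner_smul_right, norm_smul, mul_pow, Real.norm_eq_abs, sq_abs]
      ring
    have h5 : ‖φ x‖ ^ 2 * (‖x + g x‖ ^ 2 - 1) = 0 := by
      have h6 : (‖φ x‖ ^ 2 * τ x + b x) ^ 2 = D x := by
        rw [h3, neg_add_cancel_comm, h2]
      have h7 : D x = b x ^ 2 + ‖φ x‖ ^ 2 * (1 - ‖x‖ ^ 2) := rfl
      rw [h4]
      linear_combination h6 + h7
    have h6 := (mul_eq_zero.1 h5).resolve_left h1
    linarith
  obtain ⟨x, hx, hdet⟩ := exists_det_id_add_fderiv_ne_zero hUo hBU hgU hg0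
  have hxU := hBU (ball_subset_closedBall hx)
  have hgd : HasFDerivAt g (fderiv ℝ g x) x :=
    ((hgU.differentiableOn one_ne_zero).differentiableAt (hUo.mem_nhds hxU)).hasFDerivAt
  have hr : HasFDerivAt (fun y => y + g y) (ContinuousLinearMap.id ℝ E + fderiv ℝ g x) x :=
    (hasFDerivAt_id x).add hgd
  have hsq := hr.norm_sq
  have hconst : HasFDerivAt (fun y => ‖y + g y‖ ^ 2) (0 : E →L[ℝ] ℝ) x :=
    (hasFDerivAt_const (1 : ℝ) x).congr_of_eventuallyEq
      (Filter.eventually_of_mem (hUo.mem_nhds hxU) hnorm)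
  have heq := hsq.unique hconst
  -- The retraction has constant norm, so the range of its derivative is orthogonal to `x + g x`; an
  -- invertible derivative would have `x + g x` itself in its range.
  have hsurj : Function.Surjective
      ((ContinuousLinearMap.id ℝ E + fderiv ℝ g x : E →L[ℝ] E) : E →ₗ[ℝ] E) :=
    (LinearMap.equivOfDetNeZero _ hdet).surjective
  obtain ⟨h, hh⟩ := hsurj (x + g x)
  have h1 : 2 * ⟪x + g x, (ContinuousLinearMap.id ℝ E + fderiv ℝ g x) h⟫ = 0 := by
    have h2 := DFunLike.congr_fun heq h
    simp only [inner_add_left, inner_add_right, add_apply,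
      FunLike.coe_smul, Pi.smul_apply, ContinuousLinearMap.comp_apply,
      zero_apply, innerSL_apply_apply, ContinuousLinearMap.coe_id', id,
      nsmul_eq_mul, Nat.cast_ofNat, map_add] at h2 ⊢
    linarith
  have h2 : (ContinuousLinearMap.id ℝ E + fderiv ℝ g x) h = x + g x := hh
  have h3 : (2 : ℝ) * ‖x + g x‖ ^ 2 = 0 := by
    rwa [h2, real_inner_self_eq_norm_sq] at h1
  rw [hnorm x hxU] at h3
  norm_num at h3

/-- A continuous vector field on the closed unit ball which points outwards on the unit sphere has a
zero. -/
theorem exists_eq_zero_of_continuousOn_of_outward [Nontrivial E] {φ : E → E}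
    (hφ : ContinuousOn φ (closedBall 0 1))
    (hout : ∀ x ∈ sphere (0 : E) 1, 0 < ⟪x, φ x⟫) :
    ∃ x ∈ closedBall (0 : E) 1, φ x = 0 := by
  by_contra! hne
  have hρmem : ∀ x : E, (max 1 ‖x‖)⁻¹ • x ∈ closedBall (0 : E) 1 := by
    intro x
    rw [mem_closedBall_zero_iff, norm_smul, norm_inv, Real.norm_eq_abs,
      abs_of_pos (lt_max_of_lt_left one_pos), inv_mul_le_iff₀ (lt_max_of_lt_left one_pos), mul_one]
    exact le_max_right _ _
  have hρ : Continuous fun x : E => (max 1 ‖x‖)⁻¹ • x :=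
    (Continuous.inv₀ (by fun_prop) fun x => (lt_max_of_lt_left one_pos).ne').smul continuous_id
  have hφ' : Continuous fun x => φ ((max 1 ‖x‖)⁻¹ • x) := hφ.comp_continuous hρ hρmem
  obtain ⟨x₀, hx₀, hmin₀⟩ := (isCompact_closedBall (0 : E) 1).exists_isMinOn
    ⟨0, by simp⟩ hφ.norm
  obtain ⟨x₁, hx₁, hmin₁⟩ := (isCompact_sphere (0 : E) 1).exists_isMinOn
    (NormedSpace.sphere_nonempty.2 zero_le_one)
    (continuousOn_id.inner (𝕜 := ℝ) (hφ.mono sphere_subset_closedBall))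
  -- An error below `δ` preserves both outwardness on the sphere and the absence of zeros in the
  -- ball.
  set δ := min ‖φ x₀‖ ⟪x₁, φ x₁⟫ with hδ
  have hδp : 0 < δ := lt_min (norm_pos_iff.2 (hne x₀ hx₀)) (hout x₁ hx₁)
  obtain ⟨ψ, hψ, hclose, -⟩ := hφ'.exists_contDiff_approx 1 (ε := fun _ => δ) continuous_const
    fun _ => hδp
  have hclose' : ∀ x ∈ closedBall (0 : E) 1, ‖ψ x - φ x‖ < δ := by
    intro x hx
    have := hclose x
    rwa [max_eq_left (by simpa using hx), inv_one, one_smul, dist_eq_norm] at this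
  obtain ⟨x, hx, hx0⟩ := exists_eq_zero_of_contDiff_of_outward (φ := ψ) (by exact_mod_cast hψ) (by
    intro x hx
    have h1 := hclose' x (sphere_subset_closedBall hx)
    have h2 : |⟪x, ψ x - φ x⟫| ≤ ‖ψ x - φ x‖ := by
      simpa [mem_sphere_zero_iff_norm.1 hx] using abs_real_inner_le_norm x (ψ x - φ x)
    have h3 : δ ≤ ⟪x, φ x⟫ := (min_le_right _ _).trans (hmin₁ hx)
    rw [inner_sub_right] at h2
    linarith [(abs_le.1 h2).1])
  have h1 := hclose' x hx
  rw [hx0, zero_sub, norm_neg] at h1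
  have h2 : δ ≤ ‖φ x‖ := (min_le_left _ _).trans (hmin₀ hx)
  linarith

end VectorFieldZero

/-! ### Uniqueness, continuity and curvature of the gapped minimizers. -/

section GappedQuadraticMap

open Metric Set
open scoped RealInnerProductSpace

variable {V E : Type*} [NormedAddCommGroup V] [InnerProductSpace ℝ V]
  [NormedAddCommGroup E] [InnerProductSpace ℝ E]

/-- The unit vector `x` minimizes `⟪A c x, x⟫ - 2 ⟪v c, x⟫` on the unit sphere, with Lagrange
multiplier `μ`. -/
structure IsSphereMin (A : V →L[ℝ] E →L[ℝ] E) (v : V →L[ℝ] E) (c : V) (x : E) (μ : ℝ) : Prop where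
  norm_eq : ‖x‖ = 1
  eq : A c x + μ • x = v c
  nonneg : ∀ z, 0 ≤ ⟪A c z, z⟫ + μ * ‖z‖ ^ 2

/-- `f` is the quadratic map with `⟪c, f x⟫ = ⟪A c x, x⟫ - 2 ⟪v c, x⟫`; for each unit vector `c` the
point `X c` minimizes `⟪c, f x⟫` on the unit sphere with multiplier `M c`, and for all such minimizers
the form `A c + μ` is bounded below by `ε`. -/
structure IsGapped (A : V →L[ℝ] E →L[ℝ] E) (v : V →L[ℝ] E) (f : E → V) (ε : ℝ) (X : V → E)
    (M : V → ℝ) : Prop where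
  pos : 0 < ε
  symm : ∀ c x y, ⟪A c x, y⟫ = ⟪x, A c y⟫
  inner_apply : ∀ c x, ⟪c, f x⟫ = ⟪A c x, x⟫ - 2 * ⟪v c, x⟫
  isSphereMin : ∀ c, ‖c‖ = 1 → IsSphereMin A v c (X c) (M c)
  gap : ∀ c x μ, ‖c‖ = 1 → IsSphereMin A v c x μ → ∀ z, ε * ‖z‖ ^ 2 ≤ ⟪A c z, z⟫ + μ * ‖z‖ ^ 2

variable {A : V →L[ℝ] E →L[ℝ] E} {v : V →L[ℝ] E} {f : E → V} {ε : ℝ} {X : V → E} {M : V → ℝ}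

theorem IsSphereMin.smul {c : V} {x : E} {μ : ℝ} (h : IsSphereMin A v c x μ) {s : ℝ} (hs : 0 ≤ s) :
    IsSphereMin A v (s • c) x (s * μ) where
  norm_eq := h.norm_eq
  eq := by rw [map_smul, map_smul, ← h.eq, smul_add, mul_smul]; rfl
  nonneg z := by
    have := mul_nonneg hs (h.nonneg z)
    rw [map_smul, smul_apply, inner_smul_left, conj_trivial]
    linarith

namespace IsGapped

theorem gap_smul (h : IsGapped A v f ε X M) {c : V} {x : E} {μ : ℝ} (hc : c ≠ 0)
    (hx : IsSphereMin A v c x μ) (z : E) :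
    ε * ‖c‖ * ‖z‖ ^ 2 ≤ ⟪A c z, z⟫ + μ * ‖z‖ ^ 2 := by
  have hn : 0 < ‖c‖ := norm_pos_iff.2 hc
  have h1 := h.gap (‖c‖⁻¹ • c) x (‖c‖⁻¹ * μ) (norm_smul_inv_norm (𝕜 := ℝ) hc)
    (hx.smul (inv_nonneg.2 hn.le)) z
  rw [map_smul, smul_apply, inner_smul_left, conj_trivial, mul_assoc, ← mul_add] at h1
  rw [le_inv_mul_iff₀ hn] at h1
  linarith

/-- For unit `p` the right-hand side is exactly `⟪(A c + μ) (p - x), p - x⟫`: the Lagrange equation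
absorbs the linear terms and `‖p‖ = ‖x‖` cancels the constants. -/
theorem sq_dist_le (h : IsGapped A v f ε X M) {c : V} {x : E} {μ : ℝ} (hc : c ≠ 0)
    (hx : IsSphereMin A v c x μ) {p : E} (hp : ‖p‖ = 1) :
    ε * ‖c‖ * ‖p - x‖ ^ 2 ≤ ⟪c, f p⟫ - ⟪c, f x⟫ := by
  refine (h.gap_smul hc hx (p - x)).trans_eq ?_
  have h1 : ⟪x, x⟫ = (1 : ℝ) := by rw [real_inner_self_eq_norm_sq, hx.norm_eq]; norm_num
  have h2 : ⟪p, p⟫ = (1 : ℝ) := by rw [real_inner_self_eq_norm_sq, hp]; norm_num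
  have h3 : ⟪A c p, x⟫ = ⟪A c x, p⟫ := by rw [h.symm, real_inner_comm]
  rw [h.inner_apply, h.inner_apply, ← hx.eq, ← real_inner_self_eq_norm_sq]
  simp only [map_sub, inner_sub_left, inner_sub_right, inner_add_left, inner_smul_left,
    conj_trivial, h1, h2, h3, real_inner_comm x p]
  ring

theorem eq_of_isSphereMin (h : IsGapped A v f ε X M) {c : V} {x y : E} {μ ν : ℝ} (hc : c ≠ 0)
    (hx : IsSphereMin A v c x μ) (hy : IsSphereMin A v c y ν) : x = y := by
  have h1 := h.sq_dist_le hc hx hy.norm_eq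
  have h2 := h.sq_dist_le hc hy hx.norm_eq
  have h3 : 0 < ε * ‖c‖ := mul_pos h.pos (norm_pos_iff.2 hc)
  rw [norm_sub_rev y x] at h1
  have h4 : ε * ‖c‖ * ‖x - y‖ ^ 2 ≤ 0 := by linarith
  have h5 : ‖x - y‖ ^ 2 ≤ 0 := by
    by_contra! hcon
    exact absurd (mul_pos h3 hcon) (not_lt.2 h4)
  exact sub_eq_zero.1 (norm_eq_zero.1 (pow_eq_zero_iff two_ne_zero |>.1 (le_antisymm h5
    (sq_nonneg _))))

/-- The difference is tested against the direction `c = f p - f q` itself. The summand 1 only keeps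
the constant positive. -/
theorem norm_apply_sub_le (h : IsGapped A v f ε X M) {p q : E} (hp : ‖p‖ = 1) (hq : ‖q‖ = 1) :
    ‖f p - f q‖ ≤ (2 * ‖A‖ + 2 * ‖v‖ + 1) * ‖p - q‖ := by
  set c := f p - f q with hc
  have h1 : ‖c‖ ^ 2 = ⟪A c (p - q), p⟫ + ⟪A c q, p - q⟫ - 2 * ⟪v c, p - q⟫ := by
    rw [← real_inner_self_eq_norm_sq]
    nth_rewrite 2 [hc]
    rw [inner_sub_right, h.inner_apply, h.inner_apply]
    simp only [map_sub, inner_sub_left, inner_sub_right]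
    ring
  have h2 : ∀ a b : E, ⟪A c a, b⟫ ≤ ‖A‖ * ‖c‖ * ‖a‖ * ‖b‖ := fun a b =>
    (real_inner_le_norm _ _).trans (by gcongr; exact A.le_opNorm₂ c a)
  have h3 : -⟪v c, p - q⟫ ≤ ‖v‖ * ‖c‖ * ‖p - q‖ := by
    refine (neg_le_abs _).trans ((abs_real_inner_le_norm _ _).trans ?_)
    gcongr
    exact v.le_opNorm c
  have h4 := h2 (p - q) p
  have h5 := h2 q (p - q)
  rw [hp, mul_one] at h4
  rw [hq, mul_one] at h5
  have h6 : ‖c‖ * ‖c‖ ≤ ‖c‖ * ((2 * ‖A‖ + 2 * ‖v‖ + 1) * ‖p - q‖) := by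
    have : 0 ≤ ‖c‖ * ‖p - q‖ := by positivity
    linarith
  rcases (norm_nonneg c).eq_or_lt with h0 | h0
  · rw [← h0]; positivity
  · exact le_of_mul_le_mul_left h6 h0

/-- Adding the quadratic growth estimates at `X c` and at `X d` bounds `2 ε ‖X c - X d‖²` by `⟪c -
d, f (X d) - f (X c)⟫`, so `X` is Lipschitz. -/
theorem continuousOn_min (h : IsGapped A v f ε X M) : ContinuousOn X (sphere 0 1) := by
  set L := 2 * ‖A‖ + 2 * ‖v‖ + 1 with hL
  refine LipschitzOnWith.continuousOn (K := (L / (2 * ε)).toNNReal) ?_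
  refine LipschitzOnWith.of_dist_le_mul fun c hc d hd => ?_
  have hc1 : ‖c‖ = 1 := by simpa using hc
  have hd1 : ‖d‖ = 1 := by simpa using hd
  have hε := h.pos
  rw [Real.coe_toNNReal _ (by positivity), dist_eq_norm, dist_eq_norm]
  have h1 := h.sq_dist_le (norm_ne_zero_iff.1 (by simp [hc1])) (h.isSphereMin c hc1)
    (h.isSphereMin d hd1).norm_eq
  have h2 := h.sq_dist_le (norm_ne_zero_iff.1 (by simp [hd1])) (h.isSphereMin d hd1)
    (h.isSphereMin c hc1).norm_eq
  rw [hc1, mul_one, norm_sub_rev] at h1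
  rw [hd1, mul_one] at h2
  have h3 : ⟪c - d, f (X d) - f (X c)⟫ ≤ ‖c - d‖ * (L * ‖X c - X d‖) := by
    refine (real_inner_le_norm _ _).trans ?_
    rw [norm_sub_rev (f (X d))]
    gcongr
    exact h.norm_apply_sub_le (h.isSphereMin c hc1).norm_eq (h.isSphereMin d hd1).norm_eq
  simp only [inner_sub_left, inner_sub_right] at h3
  have h4 : ‖X c - X d‖ * (2 * ε * ‖X c - X d‖) ≤ ‖X c - X d‖ * (L * ‖c - d‖) := by
    nlinarith
  rcases (norm_nonneg (X c - X d)).eq_or_lt with h0 | h0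
  · rw [← h0]; positivity
  · have := le_of_mul_le_mul_left h4 h0
    rw [div_mul_eq_mul_div, le_div_iff₀ (by positivity)]
    linarith

/-- The curvature bound: the image of the unit sphere lies in a ball that touches it at `f (X c)`. -/
theorem mul_sq_norm_apply_sub_le (h : IsGapped A v f ε X M) {c : V} (hc : ‖c‖ = 1) {p : E}
    (hp : ‖p‖ = 1) :
    ε / (2 * ‖A‖ + 2 * ‖v‖ + 1) ^ 2 * ‖f p - f (X c)‖ ^ 2 ≤ ⟪c, f p - f (X c)⟫ := by
  have h1 := h.sq_dist_le (norm_ne_zero_iff.1 (by simp [hc])) (h.isSphereMin c hc) hp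
  rw [hc, mul_one] at h1
  rw [inner_sub_right]
  refine le_trans ?_ h1
  have h2 := h.norm_apply_sub_le hp (h.isSphereMin c hc).norm_eq
  have hε := h.pos
  have hL : 0 < 2 * ‖A‖ + 2 * ‖v‖ + 1 := by positivity
  have h3 : ‖f p - f (X c)‖ ^ 2 ≤ (2 * ‖A‖ + 2 * ‖v‖ + 1) ^ 2 * ‖p - X c‖ ^ 2 := by
    rw [← mul_pow]; gcongr
  rw [div_mul_eq_mul_div, div_le_iff₀ (by positivity)]
  calc ε * ‖f p - f (X c)‖ ^ 2
      ≤ ε * ((2 * ‖A‖ + 2 * ‖v‖ + 1) ^ 2 * ‖p - X c‖ ^ 2) := by gcongr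
    _ = _ := by ring

theorem mul_sq_norm_sub_le_of_mem_closure_convexHull (h : IsGapped A v f ε X M) {c : V}
    (hc : ‖c‖ = 1) {y : V} (hy : y ∈ closure (convexHull ℝ (f '' sphere 0 1))) :
    ε / (2 * ‖A‖ + 2 * ‖v‖ + 1) ^ 2 * ‖y - f (X c)‖ ^ 2 ≤ ⟪c, y - f (X c)⟫ := by
  set κ := ε / (2 * ‖A‖ + 2 * ‖v‖ + 1) ^ 2 with hκ
  have hε := h.pos
  have hκp : 0 < κ := by positivity
  set r := 1 / (2 * κ) with hr
  have hrp : 0 < r := by positivity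
  have hrκ : 2 * r * κ = 1 := by rw [hr]; field_simp
  -- The curvature inequality at `z` is membership in a ball of radius `1 / (2κ)` tangent at `f (X
  -- c)`. Balls are closed and convex, so it passes to the closed hull.
  have hball : ∀ z, z ∈ closedBall (f (X c) + r • c) r ↔
      κ * ‖z - f (X c)‖ ^ 2 ≤ ⟪c, z - f (X c)⟫ := by
    intro z
    rw [mem_closedBall, dist_eq_norm, ← sub_sub, ← sq_le_sq₀ (norm_nonneg _) hrp.le,
      norm_sub_sq_real, inner_smul_right, norm_smul, hc, mul_one, Real.norm_eq_abs, sq_abs,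
      real_inner_comm]
    constructor
    · intro h1
      have h2 : κ * (‖z - f (X c)‖ ^ 2) ≤ κ * (2 * (r * ⟪c, z - f (X c)⟫)) := by
        gcongr; linarith
      calc _ ≤ _ := h2
        _ = 2 * r * κ * ⟪c, z - f (X c)⟫ := by ring
        _ = _ := by rw [hrκ, one_mul]
    · intro h1
      have h2 : 2 * r * (κ * ‖z - f (X c)‖ ^ 2) ≤ 2 * r * ⟪c, z - f (X c)⟫ := by gcongr
      rw [← mul_assoc, hrκ] at h2
      linarith
  have hsub : f '' sphere 0 1 ⊆ closedBall (f (X c) + r • c) r := by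
    rintro _ ⟨p, hp, rfl⟩
    exact (hball _).2 (h.mul_sq_norm_apply_sub_le hc (by simpa using hp))
  exact (hball y).1 (closure_minimal (convexHull_min hsub (convex_closedBall _ _))
    isClosed_closedBall hy)

theorem eq_of_mem_closure_convexHull_of_inner_le (h : IsGapped A v f ε X M) {c : V}
    (hc : ‖c‖ = 1) {y : V} (hy : y ∈ closure (convexHull ℝ (f '' sphere 0 1)))
    (hle : ⟪c, y⟫ ≤ ⟪c, f (X c)⟫) : y = f (X c) := by
  have h1 := h.mul_sq_norm_sub_le_of_mem_closure_convexHull hc hy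
  rw [inner_sub_right] at h1
  have hε := h.pos
  have hκp : 0 < ε / (2 * ‖A‖ + 2 * ‖v‖ + 1) ^ 2 := by positivity
  have h5 : ‖y - f (X c)‖ ^ 2 ≤ 0 := by
    by_contra! hcon
    linarith [mul_pos hκp hcon]
  exact sub_eq_zero.1 (norm_eq_zero.1 (pow_eq_zero_iff two_ne_zero |>.1 (le_antisymm h5
    (sq_nonneg _))))

theorem inner_le_of_mem_closure_convexHull (h : IsGapped A v f ε X M) {c : V}
    (hc : ‖c‖ = 1) {y : V} (hy : y ∈ closure (convexHull ℝ (f '' sphere 0 1))) :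
    ⟪c, f (X c)⟫ ≤ ⟪c, y⟫ := by
  have h1 := h.mul_sq_norm_sub_le_of_mem_closure_convexHull hc hy
  rw [inner_sub_right] at h1
  have hε := h.pos
  have : 0 ≤ ε / (2 * ‖A‖ + 2 * ‖v‖ + 1) ^ 2 * ‖y - f (X c)‖ ^ 2 := by positivity
  linarith

/-- The boundary is smooth at `f x`: the only outward directions there are multiples of `c`. -/
theorem eq_zero_of_inner_eq_zero (h : IsGapped A v f ε X M) {c d : V} {x : E} {μ ν : ℝ} (hc : c ≠ 0)
    (hx : IsSphereMin A v c x μ) (hd : A d x + ν • x = v d) (hcd : ⟪c, d⟫ = 0) : d = 0 := by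
  by_contra hd0
  -- By linearity `x` satisfies the Lagrange equation for every `c + t • d`. The set of `t` with a
  -- nonnegative form is closed, and the gap makes it open, so it is all of `ℝ`. At `±t` the gap
  -- grows like `ε t ‖d‖`, while the two forms at `x` add up to the fixed number `2q`.
  set T : Set ℝ := {t | ∀ z, 0 ≤ ⟪A (c + t • d) z, z⟫ + (μ + t * ν) * ‖z‖ ^ 2} with hT
  have hnorm : ∀ t : ℝ, ‖c‖ ≤ ‖c + t • d‖ ∧ |t| * ‖d‖ ≤ ‖c + t • d‖ := by
    intro t
    have h1 : ‖c + t • d‖ ^ 2 = ‖c‖ ^ 2 + (|t| * ‖d‖) ^ 2 := by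
      rw [norm_add_sq_real, inner_smul_right, hcd, norm_smul, Real.norm_eq_abs]
      ring
    constructor <;> refine le_of_sq_le_sq ?_ (norm_nonneg _) <;> nlinarith [sq_nonneg ‖c‖, sq_nonneg (|t| * ‖d‖)]
  have hcp : 0 < ‖c‖ := norm_pos_iff.2 hc
  have hdp : 0 < ‖d‖ := norm_pos_iff.2 hd0
  have hε := h.pos
  have hmin : ∀ t ∈ T, IsSphereMin A v (c + t • d) x (μ + t * ν) := fun t ht =>
    ⟨hx.norm_eq, by
      rw [map_add, map_add, map_smul, map_smul, ← hx.eq, ← hd, add_apply, smul_apply]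
      module, ht⟩
  have hgap : ∀ t ∈ T, ∀ z, ε * ‖c + t • d‖ * ‖z‖ ^ 2 ≤
      ⟪A (c + t • d) z, z⟫ + (μ + t * ν) * ‖z‖ ^ 2 := fun t ht =>
    h.gap_smul (norm_pos_iff.1 (hcp.trans_le (hnorm t).1)) (hmin t ht)
  have hexp : ∀ t z, ⟪A (c + t • d) z, z⟫ + (μ + t * ν) * ‖z‖ ^ 2 =
      (⟪A c z, z⟫ + μ * ‖z‖ ^ 2) + t * (⟪A d z, z⟫ + ν * ‖z‖ ^ 2) := by
    intro t z
    rw [map_add, map_smul, add_apply, smul_apply, inner_add_left, inner_smul_left, conj_trivial]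
    ring
  have hclosed : IsClosed T := by
    have : T = ⋂ z, {t | 0 ≤ ⟪A (c + t • d) z, z⟫ + (μ + t * ν) * ‖z‖ ^ 2} := by
      ext t; simp [hT]
    rw [this]
    refine isClosed_iInter fun z => isClosed_le continuous_const ?_
    simp only [hexp]
    fun_prop
  have hopen : IsOpen T := by
    rw [Metric.isOpen_iff]
    intro t ht
    set B := ‖A d‖ + |ν| + 1 with hB
    have hBp : 0 < B := by positivity
    refine ⟨ε * ‖c‖ / B, by positivity, fun s hs z => ?_⟩
    have hst : |s - t| * B ≤ ε * ‖c‖ := by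
      rw [mem_ball, Real.dist_eq, lt_div_iff₀ hBp] at hs
      exact hs.le
    have hr : |⟪A d z, z⟫ + ν * ‖z‖ ^ 2| ≤ B * ‖z‖ ^ 2 := by
      have h1 : |⟪A d z, z⟫| ≤ ‖A d‖ * ‖z‖ * ‖z‖ :=
        (abs_real_inner_le_norm _ _).trans (by gcongr; exact (A d).le_opNorm z)
      have h2 : |ν * ‖z‖ ^ 2| = |ν| * ‖z‖ ^ 2 := by rw [abs_mul, abs_of_nonneg (sq_nonneg ‖z‖)]
      have h3 := abs_add_le ⟪A d z, z⟫ (ν * ‖z‖ ^ 2)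
      rw [hB]
      nlinarith [sq_nonneg ‖z‖]
    have h1 := hgap t ht z
    rw [hexp] at h1 ⊢
    have h2 : |(s - t) * (⟪A d z, z⟫ + ν * ‖z‖ ^ 2)| ≤ ε * ‖c‖ * ‖z‖ ^ 2 := by
      rw [abs_mul]
      calc _ ≤ |s - t| * (B * ‖z‖ ^ 2) := by gcongr
        _ = |s - t| * B * ‖z‖ ^ 2 := by ring
        _ ≤ _ := by gcongr
    have h3 : ε * ‖c‖ * ‖z‖ ^ 2 ≤ ε * ‖c + t • d‖ * ‖z‖ ^ 2 := by
      gcongr; exact (hnorm t).1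
    have h4 := (abs_le.1 h2).1
    linarith
  have h0 : (0 : ℝ) ∈ T := fun z => by simpa using hx.nonneg z
  have huniv : T = univ := IsClopen.eq_univ ⟨hclosed, hopen⟩ ⟨0, h0⟩
  set q := ⟪A c x, x⟫ + μ * ‖x‖ ^ 2 with hq
  have hq0 : 0 ≤ q := hx.nonneg x
  set t := (q + 1) / (ε * ‖d‖) with ht
  have htp : 0 < t := by positivity
  have h1 := hgap t (huniv ▸ mem_univ t) x
  have h2 := hgap (-t) (huniv ▸ mem_univ (-t)) x
  have h3 := (hnorm t).2
  have h4 := (hnorm (-t)).2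
  rw [abs_neg] at h4
  rw [abs_of_pos htp] at h3 h4
  rw [hexp, hx.norm_eq, one_pow, mul_one] at h1 h2
  have h5 : ε * (t * ‖d‖) = q + 1 := by rw [ht]; field_simp
  have h6 := mul_le_mul_of_nonneg_left h3 hε.le
  have h7 := mul_le_mul_of_nonneg_left h4 hε.le
  rw [hx.norm_eq, one_pow, mul_one] at hq
  linarith

end IsGapped

end GappedQuadraticMap

/-! ### More source than target dimensions: filling and strong convexity. -/

section GappedQuadraticMap

open Metric Set
open scoped RealInnerProductSpace

variable {V E : Type*} [NormedAddCommGroup V] [InnerProductSpace ℝ V]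
  [NormedAddCommGroup E] [InnerProductSpace ℝ E]
  {A : V →L[ℝ] E →L[ℝ] E} {v : V →L[ℝ] E} {f : E → V} {ε : ℝ} {X : V → E} {M : V → ℝ}

namespace IsGapped

/-- Subtracting the component of `d` along `c` leaves a Lagrange direction orthogonal to `c`, which
must vanish. -/
theorem eq_inner_smul_of_isSphereMin (h : IsGapped A v f ε X M) {c d : V} {x : E} {μ ν : ℝ}
    (hc : ‖c‖ = 1) (hx : IsSphereMin A v c x μ) (hd : A d x + ν • x = v d) :
    d = ⟪c, d⟫ • c ∧ ν = ⟪c, d⟫ * μ := by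
  set s := ⟪c, d⟫ with hs
  have hcc : ⟪c, c⟫ = (1 : ℝ) := by rw [real_inner_self_eq_norm_sq, hc]; norm_num
  have h1 : d - s • c = 0 := by
    refine h.eq_zero_of_inner_eq_zero (ν := ν - s * μ) (norm_ne_zero_iff.1 (by simp [hc])) hx ?_ ?_
    · rw [map_sub, map_sub, map_smul, map_smul, ← hd, ← hx.eq, sub_apply, smul_apply]
      module
    · rw [inner_sub_right, inner_smul_right, hcc, mul_one, hs, sub_self]
  have h2 : d = s • c := sub_eq_zero.1 h1
  refine ⟨h2, ?_⟩
  have h3 : (ν - s * μ) • x = 0 := by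
    rw [h2, map_smul, map_smul, ← hx.eq, smul_apply, smul_add] at hd
    have := add_left_cancel hd
    rw [sub_smul, this, mul_smul, sub_self]
  have hx0 : x ≠ 0 := norm_ne_zero_iff.1 (by simp [hx.norm_eq])
  exact sub_eq_zero.1 ((smul_eq_zero.1 h3).resolve_right hx0)

/-- The form for `d` is `⟪c, d⟫` times the form for `c`, and the gap makes both positive at `x`. In
particular opposite directions have different minimizers. -/
theorem inner_pos_of_isSphereMin (h : IsGapped A v f ε X M) {c d : V} {x : E} {μ ν : ℝ}
    (hc : ‖c‖ = 1) (hd : ‖d‖ = 1) (hx : IsSphereMin A v c x μ) (hx' : IsSphereMin A v d x ν) :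
    0 < ⟪c, d⟫ := by
  obtain ⟨h1, h2⟩ := h.eq_inner_smul_of_isSphereMin hc hx hx'.eq
  have h3 := h.gap c x μ hc hx x
  have h4 := h.gap d x ν hd hx' x
  have h5 : ⟪A d x, x⟫ = ⟪c, d⟫ * ⟪A c x, x⟫ := by
    conv_lhs => rw [h1]
    rw [map_smul, smul_apply, inner_smul_left, conj_trivial]
  rw [h5, h2, hx.norm_eq] at h4
  rw [hx.norm_eq] at h3
  have hε := h.pos
  by_contra! hcon
  nlinarith

theorem continuousOn_apply (h : IsGapped A v f ε X M) : ContinuousOn f (sphere 0 1) := by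
  refine LipschitzOnWith.continuousOn (K := (2 * ‖A‖ + 2 * ‖v‖ + 1).toNNReal) ?_
  refine LipschitzOnWith.of_dist_le_mul fun p hp q hq => ?_
  rw [Real.coe_toNNReal _ (by positivity), dist_eq_norm, dist_eq_norm]
  exact h.norm_apply_sub_le (by simpa using hp) (by simpa using hq)

theorem inner_min_pos (h : IsGapped A v f ε X M) {c : V} (hc : ‖c‖ = 1) : 0 < ⟪X c, v c⟫ := by
  have hm := h.isSphereMin c hc
  have h1 := h.gap c _ _ hc hm (X c)
  rw [← hm.eq, inner_add_right, inner_smul_right, real_inner_self_eq_norm_sq, real_inner_comm]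
  rw [hm.norm_eq] at h1 ⊢
  linarith [h.pos]

theorem continuous_cone_min (h : IsGapped A v f ε X M) :
    Continuous fun c : V => ‖c‖ ^ 2 • X (‖c‖⁻¹ • c) := by
  rw [continuous_iff_continuousAt]
  intro c
  rcases eq_or_ne c 0 with rfl | hc
  · have hn : ∀ d : V, ‖‖d‖ ^ 2 • X (‖d‖⁻¹ • d)‖ ≤ ‖d‖ ^ 2 := by
      intro d
      rcases eq_or_ne d 0 with rfl | hd
      · simp
      · have h1 : ‖X (‖d‖⁻¹ • d)‖ = 1 :=
          (h.isSphereMin _ (norm_smul_inv_norm (𝕜 := ℝ) hd)).norm_eq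
        rw [norm_smul, h1]
        simp
    have ht : Filter.Tendsto (fun d : V => ‖d‖ ^ 2) (nhds 0) (nhds 0) := by
      have : Continuous fun d : V => ‖d‖ ^ 2 := by fun_prop
      simpa using this.tendsto 0
    simpa [ContinuousAt] using squeeze_zero_norm hn ht
  · have h1 : ContinuousOn (fun c : V => ‖c‖⁻¹ • c) {c | c ≠ 0} :=
      ContinuousOn.smul (continuousOn_id.norm.inv₀ fun x hx => norm_ne_zero_iff.2 hx) continuousOn_id
    have h2 : ContinuousOn (fun c : V => X (‖c‖⁻¹ • c)) {c | c ≠ 0} :=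
      h.continuousOn_min.comp h1 fun x hx => by simpa using norm_smul_inv_norm (𝕜 := ℝ) hx
    have h3 : ContinuousOn (fun c : V => ‖c‖ ^ 2 • X (‖c‖⁻¹ • c)) {c | c ≠ 0} :=
      ContinuousOn.smul (by fun_prop) h2
    exact h3.continuousAt (isOpen_ne.mem_nhds hc)

variable [FiniteDimensional ℝ V]

theorem mem_image_of_forall_inner_lt [Nontrivial V] (h : IsGapped A v f ε X M)
    (hdim : Module.finrank ℝ V < Module.finrank ℝ E) {y : V}
    (hy : ∀ c, ‖c‖ = 1 → ⟪c, f (X c)⟫ < ⟪c, y⟫) : y ∈ f '' sphere 0 1 := by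
  -- This is where the strict dimension inequality enters.
  obtain ⟨w, hw, hw0⟩ : ∃ w ∈ (LinearMap.range (v : V →ₗ[ℝ] E))ᗮ, w ≠ 0 := by
    rw [← Submodule.ne_bot_iff]
    intro hbot
    rw [Submodule.orthogonal_eq_bot_iff] at hbot
    have := LinearMap.finrank_range_le (v : V →ₗ[ℝ] E)
    rw [hbot, finrank_top] at this
    omega
  have hwv : ∀ c, ⟪w, v c⟫ = 0 := fun c => by
    rw [real_inner_comm]
    exact hw (v c) ⟨c, rfl⟩
  -- `Z` equals `X` on the sphere and `w` at the origin. It never vanishes, because away from the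
  -- origin its pairing with `v (‖c‖⁻¹ • c)` is positive: `w` contributes nothing.
  set Z : V → E := fun c => ‖c‖ ^ 2 • X (‖c‖⁻¹ • c) + (1 - ‖c‖ ^ 2) • w with hZ
  have hZc : Continuous Z := h.continuous_cone_min.add (by fun_prop)
  have hZ0 : ∀ c, Z c ≠ 0 := by
    intro c hc
    rcases eq_or_ne c 0 with rfl | hc0
    · simp [hZ, hw0] at hc
    · have hcp : 0 < ‖c‖ := norm_pos_iff.2 hc0
      have h1 := h.inner_min_pos (norm_smul_inv_norm (𝕜 := ℝ) hc0)
      have h2 : ⟪Z c, v (‖c‖⁻¹ • c)⟫ = 0 := by rw [hc, inner_zero_left]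
      simp only [hZ] at h2
      rw [inner_add_left, inner_smul_left, inner_smul_left, hwv, mul_zero, add_zero,
        conj_trivial] at h2
      exact (mul_pos (pow_pos hcp 2) h1).ne' h2
  have hns : ∀ c, ‖Z c‖⁻¹ • Z c ∈ sphere (0 : E) 1 := fun c => by
    simpa using norm_smul_inv_norm (𝕜 := ℝ) (hZ0 c)
  have hφ : Continuous fun c => y - f (‖Z c‖⁻¹ • Z c) :=
    continuous_const.sub (h.continuousOn_apply.comp_continuous
      ((hZc.norm.inv₀ fun c => norm_ne_zero_iff.2 (hZ0 c)).smul hZc) hns)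
  obtain ⟨c, -, hc⟩ := exists_eq_zero_of_continuousOn_of_outward hφ.continuousOn (fun c hc => by
    have hc1 : ‖c‖ = 1 := by simpa using hc
    have h1 : Z c = X c := by simp [hZ, hc1]
    rw [h1, (h.isSphereMin c hc1).norm_eq, inv_one, one_smul, inner_sub_right, sub_pos]
    exact hy c hc1)
  exact ⟨_, hns c, (sub_eq_zero.1 hc).symm⟩

variable [FiniteDimensional ℝ E]

/-- If the dimension of the source exceeds that of the target, then the image of the sphere is the
intersection of its supporting half-spaces. -/
theorem mem_image_iff [Nontrivial V] (h : IsGapped A v f ε X M)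
    (hdim : Module.finrank ℝ V < Module.finrank ℝ E) {y : V} :
    y ∈ f '' sphere 0 1 ↔ ∀ c, ‖c‖ = 1 → ⟪c, f (X c)⟫ ≤ ⟪c, y⟫ := by
  refine ⟨fun hy c hc => h.inner_le_of_mem_closure_convexHull hc
    (subset_closure (subset_convexHull ℝ _ hy)), fun hy => ?_⟩
  obtain ⟨c₀, hc₀⟩ := exists_norm_eq V zero_le_one
  have hc₀' : ‖-c₀‖ = 1 := by rwa [norm_neg]
  -- `y₁` lies strictly inside every supporting half-space, since `X c₀` and `X (-c₀)` cannot both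
  -- equal `X c`. Moving `y` slightly towards `y₁` makes its inequalities strict, and closedness of
  -- the image returns to `y`.
  set y₁ := (1 / 2 : ℝ) • (f (X c₀) + f (X (-c₀))) with hy₁
  have hX : X c₀ ≠ X (-c₀) := by
    intro heq
    have h1 := h.isSphereMin (-c₀) hc₀'
    rw [← heq] at h1
    have h2 := h.inner_pos_of_isSphereMin hc₀ hc₀' (h.isSphereMin c₀ hc₀) h1
    rw [inner_neg_right, real_inner_self_eq_norm_sq, hc₀] at h2
    norm_num at h2
  have hstrict : ∀ c, ‖c‖ = 1 → ⟪c, f (X c)⟫ < ⟪c, y₁⟫ := by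
    intro c hc
    have hc0 : c ≠ 0 := norm_ne_zero_iff.1 (by simp [hc])
    have h1 := h.sq_dist_le hc0 (h.isSphereMin c hc) (h.isSphereMin c₀ hc₀).norm_eq
    have h2 := h.sq_dist_le hc0 (h.isSphereMin c hc) (h.isSphereMin (-c₀) hc₀').norm_eq
    rw [hc, mul_one] at h1 h2
    have h3 : 0 < ‖X c₀ - X c‖ ^ 2 + ‖X (-c₀) - X c‖ ^ 2 := by
      by_contra! hcon
      have h4 : ‖X c₀ - X c‖ ^ 2 = 0 := by
        nlinarith [sq_nonneg ‖X c₀ - X c‖, sq_nonneg ‖X (-c₀) - X c‖]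
      have h5 : ‖X (-c₀) - X c‖ ^ 2 = 0 := by
        nlinarith [sq_nonneg ‖X c₀ - X c‖, sq_nonneg ‖X (-c₀) - X c‖]
      rw [pow_eq_zero_iff two_ne_zero, norm_eq_zero, sub_eq_zero] at h4 h5
      exact hX (h4.trans h5.symm)
    have h4 := mul_pos h.pos h3
    rw [hy₁, inner_smul_right, inner_add_right]
    linarith
  have hclosed : IsClosed (f '' sphere 0 1) :=
    ((isCompact_sphere (0 : E) 1).image_of_continuousOn h.continuousOn_apply).isClosed
  have htend : Filter.Tendsto (fun t : ℝ => y + t • (y₁ - y)) (nhdsWithin 0 (Ioi 0)) (nhds y) := by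
    have : Continuous fun t : ℝ => y + t • (y₁ - y) := by fun_prop
    simpa using (this.tendsto 0).mono_left nhdsWithin_le_nhds
  refine hclosed.mem_of_tendsto htend ?_
  filter_upwards [Ioc_mem_nhdsGT (zero_lt_one' ℝ)] with t ht
  refine h.mem_image_of_forall_inner_lt hdim fun c hc => ?_
  have h1 := hy c hc
  have h2 := hstrict c hc
  rw [inner_add_right, inner_smul_right, inner_sub_right]
  nlinarith [ht.1, ht.2]

theorem closedBall_subset_image [Nontrivial V] (h : IsGapped A v f ε X M)
    (hdim : Module.finrank ℝ V < Module.finrank ℝ E) {x y : V} (hx : x ∈ f '' sphere 0 1)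
    (hy : y ∈ f '' sphere 0 1) {a b : ℝ} (ha : 0 ≤ a) (hb : 0 ≤ b) (hab : a + b = 1) :
    closedBall (a • x + b • y)
      (ε / (2 * ‖A‖ + 2 * ‖v‖ + 1) ^ 2 * a * b * ‖x - y‖ ^ 2) ⊆ f '' sphere 0 1 := by
  intro z hz
  obtain ⟨p, hp, rfl⟩ := hx
  obtain ⟨q, hq, rfl⟩ := hy
  rw [h.mem_image_iff hdim]
  intro c hc
  have hε := h.pos
  set κ := ε / (2 * ‖A‖ + 2 * ‖v‖ + 1) ^ 2 with hκ
  have hκp : 0 < κ := by positivity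
  have h1 := mul_le_mul_of_nonneg_left (h.mul_sq_norm_apply_sub_le hc (p := p) (by simpa using hp)) ha
  have h2 := mul_le_mul_of_nonneg_left (h.mul_sq_norm_apply_sub_le hc (p := q) (by simpa using hq)) hb
  rw [← hκ] at h1 h2
  set u := f p - f (X c) with hu
  set w := f q - f (X c) with hw
  have h3 : ‖f p - f q‖ ^ 2 = ‖u - w‖ ^ 2 := by rw [hu, hw, sub_sub_sub_cancel_right]
  -- This identity turns the curvature bounds at the two end points into the slack `κ a b ‖x - y‖²`
  -- at the convex combination.
  have h4 : a * ‖u‖ ^ 2 + b * ‖w‖ ^ 2 - a * b * ‖u - w‖ ^ 2 = ‖a • u + b • w‖ ^ 2 := by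
    rw [norm_sub_sq_real u w, norm_add_sq_real, inner_smul_left, inner_smul_right, norm_smul, norm_smul,
      conj_trivial, mul_pow, mul_pow, Real.norm_eq_abs, Real.norm_eq_abs, sq_abs, sq_abs]
    obtain rfl : b = 1 - a := by linarith
    ring
  have h5 : -(κ * a * b * ‖f p - f q‖ ^ 2) ≤ ⟪c, z - (a • f p + b • f q)⟫ := by
    rw [mem_closedBall, dist_eq_norm] at hz
    have h6 := abs_real_inner_le_norm c (z - (a • f p + b • f q))
    rw [hc, one_mul] at h6
    linarith [(abs_le.1 h6).1]
  have h6 : κ * (a * b * ‖u - w‖ ^ 2) ≤ κ * (a * ‖u‖ ^ 2 + b * ‖w‖ ^ 2) := by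
    gcongr
    linarith [sq_nonneg ‖a • u + b • w‖]
  have h7 : ⟪c, a • f p + b • f q⟫ = a * ⟪c, u⟫ + b * ⟪c, w⟫ + ⟪c, f (X c)⟫ := by
    rw [inner_add_right, inner_smul_right, inner_smul_right, hu, hw, inner_sub_right,
      inner_sub_right]
    obtain rfl : b = 1 - a := by linarith
    ring
  rw [inner_sub_right, h7, h3] at h5
  linarith

end IsGapped

end GappedQuadraticMap

/-! ### Equal dimensions: the empty shell. -/

section GappedQuadraticMap

open Metric Set
open scoped RealInnerProductSpace

variable {V E : Type*} [NormedAddCommGroup V] [InnerProductSpace ℝ V]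
  [NormedAddCommGroup E] [InnerProductSpace ℝ E]
  {A : V →L[ℝ] E →L[ℝ] E} {v : V →L[ℝ] E} {f : E → V} {ε : ℝ} {X : V → E} {M : V → ℝ}

namespace IsGapped

theorem multiplier_eq {c : V} {x : E} {μ : ℝ} (hx : ‖x‖ = 1) (h : A c x + μ • x = v c) :
    μ = ⟪v c - A c x, x⟫ := by
  rw [← h, add_sub_cancel_left, inner_smul_left, real_inner_self_eq_norm_sq, hx, conj_trivial,
    one_pow, mul_one]

/-- In the equidimensional case each unit vector satisfies the Lagrange condition for some
direction. -/
theorem exists_lagrange [FiniteDimensional ℝ V] [FiniteDimensional ℝ E]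
    (hdim : Module.finrank ℝ V = Module.finrank ℝ E) {x : E} (hx : ‖x‖ = 1) :
    ∃ d : V, ‖d‖ = 1 ∧ A d x + ⟪v d - A d x, x⟫ • x = v d := by
  -- The Lagrange equation is linear in the pair (direction, multiplier), and `V × ℝ` has one
  -- dimension more than `E`.
  let Λ : V × ℝ →ₗ[ℝ] E :=
    ((A.flip x - v : V →L[ℝ] E) : V →ₗ[ℝ] E).coprod (LinearMap.toSpanSingleton ℝ E x)
  have hker : LinearMap.ker Λ ≠ ⊥ := by
    apply LinearMap.ker_ne_bot_of_finrank_lt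
    rw [Module.finrank_prod, Module.finrank_self]
    omega
  obtain ⟨⟨d, ν⟩, hd, hne⟩ := (Submodule.ne_bot_iff _).1 hker
  have h1 : A d x + ν • x = v d := by
    have : A d x - v d + ν • x = 0 := by simpa [Λ] using hd
    rw [← sub_eq_zero, ← this]; abel
  have hd0 : d ≠ 0 := by
    rintro rfl
    have h2 : ν • x = 0 := by simpa using h1
    have hx0 : x ≠ 0 := norm_ne_zero_iff.1 (by simp [hx])
    exact hne (by rw [(smul_eq_zero.1 h2).resolve_right hx0]; rfl)
  have h2 : A (‖d‖⁻¹ • d) x + (‖d‖⁻¹ * ν) • x = v (‖d‖⁻¹ • d) := by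
    rw [map_smul, map_smul, ← h1, smul_apply]; module
  refine ⟨‖d‖⁻¹ • d, norm_smul_inv_norm (𝕜 := ℝ) hd0, ?_⟩
  rwa [← multiplier_eq hx h2]

/-- A unit witness and a weak inequality make the failure of nonnegativity a compact condition. -/
theorem exists_neg_of_not_nonneg {c : V} {ν : ℝ}
    (h : ¬ ∀ z, 0 ≤ ⟪A c z, z⟫ + ν * ‖z‖ ^ 2) : ∃ z, ‖z‖ = 1 ∧ ⟪A c z, z⟫ + ν ≤ 0 := by
  push Not at h
  obtain ⟨z, hz⟩ := h
  have hz0 : z ≠ 0 := by rintro rfl; simp at hz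
  have hzp : 0 < ‖z‖ := norm_pos_iff.2 hz0
  refine ⟨‖z‖⁻¹ • z, norm_smul_inv_norm (𝕜 := ℝ) hz0, ?_⟩
  rw [map_smul, inner_smul_left, inner_smul_right, conj_trivial]
  have h1 : ‖z‖⁻¹ * (‖z‖⁻¹ * ⟪A c z, z⟫) + ν =
      (‖z‖⁻¹) ^ 2 * (⟪A c z, z⟫ + ν * ‖z‖ ^ 2) := by field_simp
  rw [h1]
  exact mul_nonpos_of_nonneg_of_nonpos (sq_nonneg _) hz.le

variable [FiniteDimensional ℝ V] [Nontrivial V]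

/-- Otherwise Hahn–Banach separates `y` from the closed hull, and the normalized separating vector
violates the hypothesis. -/
theorem mem_closure_convexHull_of_forall_inner_le (h : IsGapped A v f ε X M) {y : V}
    (hy : ∀ c, ‖c‖ = 1 → ⟪c, f (X c)⟫ ≤ ⟪c, y⟫) :
    y ∈ closure (convexHull ℝ (f '' sphere 0 1)) := by
  by_contra hcon
  obtain ⟨φ, u, hφ, hu⟩ := geometric_hahn_banach_point_closed
    (convex_convexHull ℝ (f '' sphere 0 1)).closure isClosed_closure hcon
  have hmem : ∀ c, ‖c‖ = 1 → f (X c) ∈ closure (convexHull ℝ (f '' sphere 0 1)) := fun c hc =>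
    subset_closure (subset_convexHull ℝ _ ⟨_, by simpa using (h.isSphereMin c hc).norm_eq, rfl⟩)
  set a := (InnerProductSpace.toDual ℝ V).symm φ with ha
  have hφa : ∀ z, φ z = ⟪a, z⟫ := fun z => (InnerProductSpace.toDual_symm_apply).symm
  rcases eq_or_ne a 0 with ha0 | ha0
  · obtain ⟨c, hc⟩ := exists_norm_eq V zero_le_one
    have h1 := hu _ (hmem c hc)
    rw [hφa, ha0, inner_zero_left] at hφ h1
    linarith
  · have hc := norm_smul_inv_norm (𝕜 := ℝ) ha0
    have h1 := hy (‖a‖⁻¹ • a) hc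
    have h2 := hu _ (hmem (‖a‖⁻¹ • a) hc)
    rw [inner_smul_left, inner_smul_left] at h1
    have h3 := le_of_mul_le_mul_left h1 (inv_pos.2 (norm_pos_iff.2 ha0))
    rw [hφa] at hφ h2
    linarith

theorem exists_ball_forall_inner_le (h : IsGapped A v f ε X M) {y : V}
    (hy : ∀ c, ‖c‖ = 1 → ⟪c, f (X c)⟫ < ⟪c, y⟫) :
    ∃ δ > 0, ∀ z ∈ ball y δ, ∀ c, ‖c‖ = 1 → ⟪c, f (X c)⟫ ≤ ⟪c, z⟫ := by
  have hcont : ContinuousOn (fun c => ⟪c, y - f (X c)⟫) (sphere (0 : V) 1) :=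
    continuousOn_id.inner (𝕜 := ℝ) (continuousOn_const.sub
      (h.continuousOn_apply.comp h.continuousOn_min fun c hc => by
        simpa using (h.isSphereMin c (by simpa using hc)).norm_eq))
  obtain ⟨c₀, hc₀, hmin⟩ := (isCompact_sphere (0 : V) 1).exists_isMinOn
    (NormedSpace.sphere_nonempty.2 zero_le_one) hcont
  refine ⟨⟪c₀, y - f (X c₀)⟫, ?_, fun z hz c hc => ?_⟩
  · rw [inner_sub_right]
    exact sub_pos.2 (hy c₀ (by simpa using hc₀))
  · have h1 : ⟪c₀, y - f (X c₀)⟫ ≤ ⟪c, y - f (X c)⟫ := hmin (by simpa using hc)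
    have h2 := abs_real_inner_le_norm c (z - y)
    rw [hc, one_mul] at h2
    rw [mem_ball, dist_eq_norm] at hz
    have h3 := (abs_le.1 h2).1
    rw [inner_sub_right] at h3
    rw [inner_sub_right c] at h1
    linarith

theorem mem_interior_convexHull (h : IsGapped A v f ε X M) {y : V}
    (hy : ∀ c, ‖c‖ = 1 → ⟪c, f (X c)⟫ < ⟪c, y⟫) :
    y ∈ interior (convexHull ℝ (f '' sphere 0 1)) := by
  set C := convexHull ℝ (f '' sphere 0 1) with hC
  have hconv : Convex ℝ C := convex_convexHull ℝ _
  obtain ⟨δ, hδ, hball⟩ := h.exists_ball_forall_inner_le hy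
  have hint : y ∈ interior (closure C) := by
    rw [mem_interior]
    exact ⟨ball y δ, fun z hz => h.mem_closure_convexHull_of_forall_inner_le (hball z hz),
      isOpen_ball, mem_ball_self hδ⟩
  -- Closure and interior commute for convex sets only if the interior is nonempty. Here the closure
  -- has interior points, so its affine span is everything; affine subspaces being closed, `C` has
  -- the same span.
  have hne : (interior C).Nonempty := by
    rw [hconv.interior_nonempty_iff_affineSpan_eq_top]
    have h1 := affineSpan_eq_top_of_nonempty_interior (s := closure C)
      (((hconv.closure.convexHull_eq).symm ▸ ⟨y, hint⟩ : (interior (convexHull ℝ (closure C))).Nonempty))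
    refine top_le_iff.1 (h1.symm.le.trans (affineSpan_le.2 ?_))
    exact closure_minimal (subset_affineSpan ℝ C) (AffineSubspace.closed_of_finiteDimensional _)
  rwa [hconv.interior_closure_eq_interior_of_nonempty_interior hne] at hint

variable [FiniteDimensional ℝ E]

/-- In the equidimensional case every unit vector is a minimizer in some direction. -/
theorem sphere_subset_image_min (h : IsGapped A v f ε X M)
    (hdim : Module.finrank ℝ V = Module.finrank ℝ E) :
    sphere (0 : E) 1 ⊆ X '' sphere 0 1 := by
  have hmem : ∀ {x : E} {d : V} {ν : ℝ}, ‖d‖ = 1 → IsSphereMin A v d x ν →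
      x ∈ X '' sphere 0 1 := fun {x d ν} hd hx =>
    ⟨d, by simpa using hd, h.eq_of_isSphereMin (norm_ne_zero_iff.1 (by simp [hd]))
      (h.isSphereMin d hd) hx⟩
  have hneg : ∀ {x : E} {d : V} {ν : ℝ}, A d x + ν • x = v d → A (-d) x + (-ν) • x = v (-d) := by
    intro x d ν hd
    rw [map_neg, map_neg, ← hd, neg_apply]; module
  -- In dimension one the sphere is disconnected. There `z = s • x` and the form is `s² ⟪v d, x⟫`,
  -- so one of `d` and `-d` works.
  rcases (Nat.one_le_iff_ne_zero.2 (Module.finrank_pos (R := ℝ) (M := V)).ne').eq_or_lt with h1 | h1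
  · intro x hx
    have hx1 : ‖x‖ = 1 := by simpa using hx
    obtain ⟨d, hd, hdx⟩ := exists_lagrange (A := A) (v := v) hdim hx1
    set ν := ⟪v d - A d x, x⟫
    have hx0 : x ≠ 0 := norm_ne_zero_iff.1 (by simp [hx1])
    have hspan := (finrank_eq_one_iff_of_nonzero' x hx0).1 (hdim.symm.trans h1.symm)
    have hform : ∀ {e : V} {η : ℝ}, A e x + η • x = v e → ∀ s : ℝ,
        ⟪A e (s • x), s • x⟫ + η * ‖s • x‖ ^ 2 = s ^ 2 * ⟪v e, x⟫ := by
      intro e η he s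
      rw [← he, map_smul, inner_smul_left, inner_smul_right, conj_trivial, norm_smul, hx1,
        inner_add_left, inner_smul_left, real_inner_self_eq_norm_sq, hx1, Real.norm_eq_abs, mul_one,
        sq_abs, conj_trivial]
      ring
    rcases le_total 0 ⟪v d, x⟫ with hs | hs
    · refine hmem hd ⟨hx1, hdx, fun z => ?_⟩
      obtain ⟨s, rfl⟩ := hspan z
      rw [hform hdx]; positivity
    · refine hmem (by rwa [norm_neg]) ⟨hx1, hneg hdx, fun z => ?_⟩
      obtain ⟨s, rfl⟩ := hspan z
      rw [hform (hneg hdx), map_neg, inner_neg_left]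
      exact mul_nonneg (sq_nonneg _) (by linarith)
  · have hG : IsClosed (X '' sphere (0 : V) 1) :=
      ((isCompact_sphere (0 : V) 1).image_of_continuousOn h.continuousOn_min).isClosed
    -- The projection of `K` consists of the unit `x` with a unit Lagrange direction `d` whose form
    -- is neither positive definite nor negative definite. It is closed and covers the complement of
    -- the range of `X`. At `X c` the direction is a nonzero multiple of `c` and the form is
    -- definite, so the two closed sets are disjoint, and connectedness of the sphere applies.
    set K : Set (E × V × E × E) := (sphere 0 1 ×ˢ sphere 0 1 ×ˢ sphere 0 1 ×ˢ sphere 0 1) ∩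
      ({p | A p.2.1 p.1 + ⟪v p.2.1 - A p.2.1 p.1, p.1⟫ • p.1 = v p.2.1} ∩
      ({p | ⟪A p.2.1 p.2.2.1, p.2.2.1⟫ + ⟪v p.2.1 - A p.2.1 p.1, p.1⟫ ≤ 0} ∩
      {p | 0 ≤ ⟪A p.2.1 p.2.2.2, p.2.2.2⟫ + ⟪v p.2.1 - A p.2.1 p.1, p.1⟫})) with hK
    have hKc : IsCompact K := by
      refine IsCompact.inter_right ?_ ?_
      · exact (isCompact_sphere _ _).prod ((isCompact_sphere _ _).prod
          ((isCompact_sphere _ _).prod (isCompact_sphere _ _)))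
      · refine IsClosed.inter (isClosed_eq ?_ ?_) (IsClosed.inter (isClosed_le ?_ ?_)
          (isClosed_le ?_ ?_)) <;> fun_prop
    have hG' : IsClosed (Prod.fst '' K) := (hKc.image continuous_fst).isClosed
    have hcover : sphere (0 : E) 1 ⊆ X '' sphere 0 1 ∪ Prod.fst '' K := by
      intro x hx
      have hx1 : ‖x‖ = 1 := by simpa using hx
      by_cases hxG : x ∈ X '' sphere (0 : V) 1
      · exact Or.inl hxG
      obtain ⟨d, hd, hdx⟩ := exists_lagrange (A := A) (v := v) hdim hx1
      obtain ⟨z, hz, hz'⟩ := exists_neg_of_not_nonneg (A := A) (c := d)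
        fun hn => hxG (hmem hd ⟨hx1, hdx, hn⟩)
      obtain ⟨w, hw, hw'⟩ := exists_neg_of_not_nonneg (A := A) (c := -d)
        fun hn => hxG (hmem (by rwa [norm_neg]) ⟨hx1, hneg hdx, hn⟩)
      refine Or.inr ⟨(x, d, z, w), ⟨⟨hx, by simpa using hd, by simpa using hz, by simpa using hw⟩,
        hdx, hz', ?_⟩, rfl⟩
      rw [map_neg, neg_apply, inner_neg_left] at hw'
      change 0 ≤ ⟪A d w, w⟫ + ⟪v d - A d x, x⟫
      linarith
    have hdisj : ∀ x ∈ X '' sphere (0 : V) 1, x ∉ Prod.fst '' K := by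
      rintro _ ⟨c, hc, rfl⟩ ⟨⟨x, d, z, w⟩, ⟨⟨-, hd, hz, hw⟩, hdx, hz', hw'⟩, hx⟩
      change x = X c at hx
      subst hx
      have hc1 : ‖c‖ = 1 := by simpa using hc
      have hd1 : ‖d‖ = 1 := by simpa using hd
      have hz1 : ‖z‖ = 1 := by simpa using hz
      have hw1 : ‖w‖ = 1 := by simpa using hw
      change A d (X c) + ⟪v d - A d (X c), X c⟫ • X c = v d at hdx
      change ⟪A d z, z⟫ + ⟪v d - A d (X c), X c⟫ ≤ 0 at hz'
      change 0 ≤ ⟪A d w, w⟫ + ⟪v d - A d (X c), X c⟫ at hw'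
      obtain ⟨h2, h3⟩ := h.eq_inner_smul_of_isSphereMin hc1 (h.isSphereMin c hc1) hdx
      set s := ⟪c, d⟫
      have hs : s ≠ 0 := by
        intro hs
        rw [hs, zero_smul] at h2
        simp [h2] at hd1
      have h4 := h.gap c _ _ hc1 (h.isSphereMin c hc1) z
      have h5 := h.gap c _ _ hc1 (h.isSphereMin c hc1) w
      rw [h3, h2, map_smul, smul_apply, inner_smul_left, conj_trivial, ← mul_add] at hz' hw'
      rw [hz1] at h4
      rw [hw1] at h5
      have hε := h.pos
      rcases lt_or_gt_of_ne hs with hs | hs <;> nlinarith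
    have hrank : 1 < Module.rank ℝ E := by
      rw [← Module.finrank_eq_rank, ← hdim]
      exact_mod_cast h1
    have hpre := isPreconnected_sphere hrank (0 : E) 1
    rw [isPreconnected_closed_iff] at hpre
    intro x hx
    by_contra hxG
    obtain ⟨c, hc⟩ := exists_norm_eq V zero_le_one
    have hX : X c ∈ X '' sphere (0 : V) 1 := ⟨c, by simpa using hc, rfl⟩
    obtain ⟨y, -, hy1, hy2⟩ := hpre _ _ hG hG' hcover
      ⟨X c, by simpa using (h.isSphereMin c hc).norm_eq, hX⟩
      ⟨x, hx, (hcover hx).resolve_left hxG⟩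
    exact hdisj y hy1 hy2

theorem image_eq_frontier_convexHull (h : IsGapped A v f ε X M)
    (hdim : Module.finrank ℝ V = Module.finrank ℝ E) :
    f '' sphere 0 1 = frontier (convexHull ℝ (f '' sphere 0 1)) := by
  apply Subset.antisymm
  · rintro _ ⟨x, hx, rfl⟩
    refine ⟨subset_closure (subset_convexHull ℝ _ ⟨x, hx, rfl⟩), fun hint => ?_⟩
    obtain ⟨c, hc, rfl⟩ := h.sphere_subset_image_min hdim hx
    have hc1 : ‖c‖ = 1 := by simpa using hc
    rw [mem_interior_iff_mem_nhds, Metric.mem_nhds_iff] at hint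
    obtain ⟨δ, hδ, hball⟩ := hint
    have h1 : f (X c) - (δ / 2) • c ∈ ball (f (X c)) δ := by
      rw [mem_ball, dist_eq_norm, sub_sub_cancel_left, norm_neg, norm_smul, hc1, mul_one,
        Real.norm_eq_abs, abs_of_pos (by positivity)]
      linarith
    have h2 := h.inner_le_of_mem_closure_convexHull hc1 (subset_closure (hball h1))
    rw [inner_sub_right, inner_smul_right, real_inner_self_eq_norm_sq, hc1] at h2
    linarith
  · rintro y ⟨hy, hint⟩
    have h1 : ¬ ∀ c, ‖c‖ = 1 → ⟪c, f (X c)⟫ < ⟪c, y⟫ := fun hlt =>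
      hint (h.mem_interior_convexHull hlt)
    push Not at h1
    obtain ⟨c, hc, hle⟩ := h1
    rw [h.eq_of_mem_closure_convexHull_of_inner_le hc hy hle]
    exact ⟨_, by simpa using (h.isSphereMin c hc).norm_eq, rfl⟩

end IsGapped

end GappedQuadraticMap

/-! ### Smoothness of the boundary. -/

section GappedQuadraticMap

open Metric Set
open scoped RealInnerProductSpace Topology ContDiff

variable {V E : Type*} [NormedAddCommGroup V] [InnerProductSpace ℝ V]
  [NormedAddCommGroup E] [InnerProductSpace ℝ E]
  {A : V →L[ℝ] E →L[ℝ] E} {v : V →L[ℝ] E} {f : E → V} {ε : ℝ} {X : V → E} {M : V → ℝ}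

namespace IsGapped

/-- The gap absorbs small changes of direction and multiplier, so nearby Lagrange solutions of unit
norm are again minimizers. -/
theorem eventually_nonneg (h : IsGapped A v f ε X M) {c : V} {x : E} {μ : ℝ}
    (hc : ‖c‖ = 1) (hx : IsSphereMin A v c x μ) :
    ∀ᶠ q : V × ℝ in 𝓝 (c, μ), ∀ z, 0 ≤ ⟪A q.1 z, z⟫ + q.2 * ‖z‖ ^ 2 := by
  have hcont : Continuous fun q : V × ℝ => ‖A (q.1 - c)‖ + |q.2 - μ| := by fun_prop
  have hlt : ∀ᶠ q : V × ℝ in 𝓝 (c, μ), ‖A (q.1 - c)‖ + |q.2 - μ| < ε :=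
    hcont.continuousAt.eventually_lt continuousAt_const (by simpa using h.pos)
  filter_upwards [hlt] with q hq z
  have h1 := h.gap c x μ hc hx z
  have h2 : |⟪A (q.1 - c) z, z⟫| ≤ ‖A (q.1 - c)‖ * ‖z‖ * ‖z‖ :=
    (abs_real_inner_le_norm _ _).trans (by gcongr; exact (A (q.1 - c)).le_opNorm z)
  have h3 : |(q.2 - μ) * ‖z‖ ^ 2| = |q.2 - μ| * ‖z‖ ^ 2 := by
    rw [abs_mul, abs_of_nonneg (sq_nonneg ‖z‖)]
  have h4 : ⟪A q.1 z, z⟫ + q.2 * ‖z‖ ^ 2 = (⟪A c z, z⟫ + μ * ‖z‖ ^ 2) +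
      (⟪A (q.1 - c) z, z⟫ + (q.2 - μ) * ‖z‖ ^ 2) := by
    rw [map_sub, sub_apply, inner_sub_left]; ring
  have h5 := (abs_le.1 h2).1
  have h6 := neg_abs_le ((q.2 - μ) * ‖z‖ ^ 2)
  have h7 : (‖A (q.1 - c)‖ + |q.2 - μ|) * ‖z‖ ^ 2 ≤ ε * ‖z‖ ^ 2 := by gcongr
  rw [h4]
  nlinarith

variable [FiniteDimensional ℝ V]

theorem contDiff (h : IsGapped A v f ε X M) : ContDiff ℝ ω f := by
  have : f = fun x => ∑ i, (⟪A (stdOrthonormalBasis ℝ V i) x, x⟫ -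
      2 * ⟪v (stdOrthonormalBasis ℝ V i), x⟫) • stdOrthonormalBasis ℝ V i := by
    funext x
    conv_lhs => rw [← (stdOrthonormalBasis ℝ V).sum_repr' (f x)]
    simp only [h.inner_apply]
  rw [this]
  refine ContDiff.sum fun i _ => ContDiff.smul (ContDiff.sub ?_ ?_) contDiff_const
  · exact (A _).contDiff.inner ℝ contDiff_id
  · exact contDiff_const.mul (contDiff_const.inner ℝ contDiff_id)

theorem inner_fderiv (h : IsGapped A v f ε X M) (c : V) (x δ : E) :
    ⟪c, fderiv ℝ f x δ⟫ = 2 * ⟪A c x - v c, δ⟫ := by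
  have h1 : HasFDerivAt (fun x => ⟪c, f x⟫) ((innerSL ℝ c).comp (fderiv ℝ f x)) x :=
    (innerSL ℝ c).hasFDerivAt.comp x
      ((h.contDiff.differentiable (by simp)).differentiableAt.hasFDerivAt)
  have h2 : HasFDerivAt (fun x => ⟪A c x, x⟫ - 2 * ⟪v c, x⟫) _ x :=
    ((A c).hasFDerivAt.inner ℝ (hasFDerivAt_id x)).sub
      (((innerSL ℝ (v c)).hasFDerivAt (x := x)).const_mul 2)
  have h3 := DFunLike.congr_fun ((funext (h.inner_apply c) ▸ h1).unique h2) δ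
  simp at h3
  rw [h3, inner_sub_left, real_inner_comm x (A c δ), ← h.symm]
  ring

/-- Directions at an angle of at least a right angle have distinct minimizers; compactness makes
their distance uniform. -/
theorem exists_separation [Nontrivial V] (h : IsGapped A v f ε X M) :
    ∃ δ > 0, ∀ a e : V, ‖a‖ = 1 → ‖e‖ = 1 → ⟪a, e⟫ ≤ 0 → δ ≤ ‖X a - X e‖ := by
  set K : Set (V × V) := (sphere 0 1 ×ˢ sphere 0 1) ∩ {p | ⟪p.1, p.2⟫ ≤ 0} with hK
  have hKc : IsCompact K := ((isCompact_sphere _ _).prod (isCompact_sphere _ _)).inter_right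
    (isClosed_le (by fun_prop) continuous_const)
  have hKne : K.Nonempty := by
    obtain ⟨c, hc⟩ := exists_norm_eq V zero_le_one
    refine ⟨(c, -c), ⟨by simpa using hc, by simpa using hc⟩, ?_⟩
    change ⟪c, -c⟫ ≤ 0
    rw [inner_neg_right, real_inner_self_eq_norm_sq, hc]
    norm_num
  have hcont : ContinuousOn (fun p : V × V => ‖X p.1 - X p.2‖) K :=
    ((h.continuousOn_min.comp continuousOn_fst fun p hp => hp.1.1).sub
      (h.continuousOn_min.comp continuousOn_snd fun p hp => hp.1.2)).norm
  obtain ⟨⟨a₀, e₀⟩, ⟨⟨ha, he⟩, hae⟩, hmin⟩ := hKc.exists_isMinOn hKne hcont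
  have ha1 : ‖a₀‖ = 1 := by simpa using ha
  have he1 : ‖e₀‖ = 1 := by simpa using he
  refine ⟨‖X a₀ - X e₀‖, norm_pos_iff.2 (sub_ne_zero.2 fun heq => ?_), fun a e ha he hae => ?_⟩
  · have h1 := h.isSphereMin e₀ he1
    rw [← heq] at h1
    exact absurd (h.inner_pos_of_isSphereMin ha1 he1 (h.isSphereMin a₀ ha1) h1) (not_lt.2 hae)
  · exact hmin (show (a, e) ∈ K from ⟨⟨by simpa using ha, by simpa using he⟩, hae⟩)

/-- The map whose local inverse recovers the outward direction `c` from a point near the boundary of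
the image of the sphere. -/
noncomputable def boundaryChart (A : V →L[ℝ] E →L[ℝ] E) (v : V →L[ℝ] E) (f : E → V) (z : E × V × ℝ) : E × ℝ × V :=
  (A z.2.1 z.1 + z.2.2 • z.1 - v z.2.1, ‖z.1‖ ^ 2, f z.1 - (‖z.2.1‖ ^ 2 - 1) • z.2.1)

theorem contDiff_boundaryChart (h : IsGapped A v f ε X M) :
    ContDiff ℝ ω (boundaryChart A v f) := by
  have hf := h.contDiff
  have h1 : ContDiff ℝ ω fun z : E × V × ℝ => f z.1 := hf.comp contDiff_fst
  have h2 : ContDiff ℝ ω fun z : E × V × ℝ => ‖z.1‖ ^ 2 := contDiff_fst.norm_sq ℝ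
  have h3 : ContDiff ℝ ω fun z : E × V × ℝ => ‖z.2.1‖ ^ 2 :=
    (contDiff_fst.comp contDiff_snd).norm_sq ℝ
  have h4 : ContDiff ℝ ω fun z : E × V × ℝ => A z.2.1 z.1 := by fun_prop
  unfold boundaryChart
  fun_prop

/-- For a kernel vector `(δx, δc, δμ)`, pairing the last component with `c` gives `⟪c, δc⟫ = 0`,
hence `Df δx = 0`. Pairing the first with `δx` then leaves only the gapped form at `δx`, so `δx =
0`. Now `δc` is a Lagrange direction at `x` orthogonal to `c`, so it vanishes together with `δμ`. -/
theorem fderiv_boundaryChart_injective (h : IsGapped A v f ε X M) {c : V} {x : E} {μ : ℝ}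
    (hc : ‖c‖ = 1) (hx : IsSphereMin A v c x μ) :
    Function.Injective (fderiv ℝ (boundaryChart A v f) (x, c, μ)) := by
  have hx' : HasFDerivAt (fun z : E × V × ℝ => z.1) (ContinuousLinearMap.fst ℝ E (V × ℝ))
    (x, c, μ) := hasFDerivAt_fst
  have hc' : HasFDerivAt (fun z : E × V × ℝ => z.2.1)
    ((ContinuousLinearMap.fst ℝ V ℝ).comp (ContinuousLinearMap.snd ℝ E (V × ℝ))) (x, c, μ) :=
    hasFDerivAt_fst.comp _ hasFDerivAt_snd
  have hμ' : HasFDerivAt (fun z : E × V × ℝ => z.2.2)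
    ((ContinuousLinearMap.snd ℝ V ℝ).comp (ContinuousLinearMap.snd ℝ E (V × ℝ))) (x, c, μ) :=
    hasFDerivAt_snd.comp _ hasFDerivAt_snd
  have hA : HasFDerivAt (fun z : E × V × ℝ => A z.2.1) _ (x, c, μ) := A.hasFDerivAt.comp _ hc'
  have hv : HasFDerivAt (fun z : E × V × ℝ => v z.2.1) _ (x, c, μ) := v.hasFDerivAt.comp _ hc'
  have hf : HasFDerivAt (fun z : E × V × ℝ => f z.1) _ (x, c, μ) :=
    ((h.contDiff.differentiable (by simp)).differentiableAt (x := x)).hasFDerivAt.comp _ hx'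
  have h1 := ((hA.clm_apply hx').add (hμ'.smul hx')).sub hv
  have h2 := hx'.norm_sq
  have h3 := hf.sub ((hc'.norm_sq.sub_const 1).smul hc')
  have hG : HasFDerivAt (boundaryChart A v f) _ (x, c, μ) := h1.prodMk (h2.prodMk h3)
  rw [hG.fderiv, injective_iff_map_eq_zero]
  rintro ⟨δx, δc, δμ⟩ h0
  obtain ⟨e1, e2, e3⟩ : (A c δx + A δc x + (μ • δx + δμ • x) - v δc = 0) ∧ (⟪x, δx⟫ = 0) ∧
      (fderiv ℝ f x δx - (2 * ⟪c, δc⟫) • c = 0) := by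
    simpa [hc] using h0
  have e4 : ⟪c, δc⟫ = 0 := by
    have h4 := congrArg (fun y => ⟪c, y⟫) e3
    simp only [inner_sub_right, inner_smul_right, inner_zero_right, h.inner_fderiv,
      real_inner_self_eq_norm_sq, hc] at h4
    rw [← hx.eq, inner_sub_left, inner_add_left, inner_smul_left, e2] at h4
    simp at h4
    exact h4
  have e5 : fderiv ℝ f x δx = 0 := by simpa [e4] using e3
  have e6 : δx = 0 := by
    have h4 := congrArg (fun y => ⟪y, δx⟫) e1
    have h5 : ⟪A δc x - v δc, δx⟫ = 0 := by
      have := h.inner_fderiv δc x δx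
      rw [e5, inner_zero_right] at this
      linarith
    simp only [inner_sub_left, inner_add_left, inner_smul_left, inner_zero_left, e2,
      real_inner_self_eq_norm_sq, conj_trivial] at h4 h5
    have h6 := h.gap c x μ hc hx δx
    have h7 : ε * ‖δx‖ ^ 2 ≤ 0 := by linarith
    have h8 : ‖δx‖ ^ 2 ≤ 0 := by
      by_contra! hcon
      linarith [mul_pos h.pos hcon]
    exact norm_eq_zero.1 (pow_eq_zero_iff two_ne_zero |>.1 (le_antisymm h8 (sq_nonneg _)))
  subst e6
  have e7 : A δc x + δμ • x = v δc := by
    rw [map_zero, smul_zero, zero_add, zero_add] at e1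
    exact sub_eq_zero.1 e1
  obtain ⟨e8, e9⟩ := h.eq_inner_smul_of_isSphereMin hc hx e7
  rw [e4, zero_smul] at e8
  rw [e4, zero_mul] at e9
  rw [e8, e9]
  rfl

variable [FiniteDimensional ℝ E] [Nontrivial V]

theorem exists_eq_min_of_mem_frontier (h : IsGapped A v f ε X M)
    (hdim : Module.finrank ℝ V < Module.finrank ℝ E) {p : V} (hp : p ∈ frontier (f '' sphere 0 1)) :
    ∃ c, ‖c‖ = 1 ∧ p = f (X c) := by
  have hclosed : IsClosed (f '' sphere 0 1) :=
    ((isCompact_sphere (0 : E) 1).image_of_continuousOn h.continuousOn_apply).isClosed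
  have h1 : ¬ ∀ c, ‖c‖ = 1 → ⟪c, f (X c)⟫ < ⟪c, p⟫ := by
    intro hlt
    obtain ⟨δ, hδ, hball⟩ := h.exists_ball_forall_inner_le hlt
    exact hp.2 (mem_interior.2 ⟨ball p δ, fun z hz => (h.mem_image_iff hdim).2 (hball z hz),
      isOpen_ball, mem_ball_self hδ⟩)
  push Not at h1
  obtain ⟨c, hc, hle⟩ := h1
  exact ⟨c, hc, h.eq_of_mem_closure_convexHull_of_inner_le hc
    (subset_closure (subset_convexHull ℝ _ (hclosed.frontier_subset hp))) hle⟩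

/-- Points slightly inside of a boundary point, along the inner normal, belong to the image. -/
theorem exists_forall_add_smul_mem (h : IsGapped A v f ε X M)
    (hdim : Module.finrank ℝ V < Module.finrank ℝ E) :
    ∃ η > 0, ∀ (c : V) (x : E) (μ τ : ℝ), c ≠ 0 → ‖c‖ ≤ 1 → IsSphereMin A v c x μ → 0 ≤ τ →
      τ ≤ η → f x + τ • c ∈ f '' sphere 0 1 := by
  obtain ⟨δ, hδ, hsep⟩ := h.exists_separation
  have hε := h.pos
  refine ⟨ε * δ ^ 2, by positivity, fun c x μ τ hc hc1 hx hτ hτη => ?_⟩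
  rw [h.mem_image_iff hdim]
  intro e he
  have hcp : 0 < ‖c‖ := norm_pos_iff.2 hc
  have h1 := h.sq_dist_le (norm_ne_zero_iff.1 (by simp [he])) (h.isSphereMin e he) hx.norm_eq
  rw [he, mul_one] at h1
  rw [inner_add_right, inner_smul_right]
  -- When `e` and `c` point the same way, adding `τ • c` only helps. Otherwise `x` is at distance at
  -- least `δ` from `X e`, and the slack `ε δ²` exceeds the loss, which is at most `τ`.
  rcases le_total 0 ⟪e, c⟫ with hec | hec
  · have h2 : 0 ≤ τ * ⟪e, c⟫ := mul_nonneg hτ hec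
    have h3 : 0 ≤ ε * ‖x - X e‖ ^ 2 := by positivity
    linarith
  · have hu : ‖‖c‖⁻¹ • c‖ = 1 := norm_smul_inv_norm (𝕜 := ℝ) hc
    have h2 : x = X (‖c‖⁻¹ • c) := h.eq_of_isSphereMin (norm_ne_zero_iff.1 (by rw [hu]; simp))
      (hx.smul (inv_nonneg.2 hcp.le)) (h.isSphereMin _ hu)
    have h3 := hsep (‖c‖⁻¹ • c) e hu he (by
      rw [inner_smul_left, real_inner_comm]
      exact mul_nonpos_of_nonneg_of_nonpos (inv_nonneg.2 hcp.le) hec)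
    rw [← h2] at h3
    have h4 : ε * δ ^ 2 ≤ ε * ‖x - X e‖ ^ 2 := by gcongr
    have h5 := abs_real_inner_le_norm e c
    rw [he, one_mul] at h5
    have h6 := (abs_le.1 h5).1
    nlinarith

theorem exists_smooth_defining_function (h : IsGapped A v f ε X M)
    (hdim : Module.finrank ℝ V < Module.finrank ℝ E) {p : V} (hp : p ∈ frontier (f '' sphere 0 1)) :
    ∃ U : Set V, IsOpen U ∧ p ∈ U ∧ ∃ g : V → ℝ, ContDiffOn ℝ ∞ g U ∧ fderiv ℝ g p ≠ 0 ∧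
      ∀ y ∈ U, y ∈ f '' sphere 0 1 ↔ g y ≤ 0 := by
  obtain ⟨c₀, hc₀, rfl⟩ := h.exists_eq_min_of_mem_frontier hdim hp
  have hx₀ := h.isSphereMin c₀ hc₀
  set x₀ := X c₀ with hx₀def
  set μ₀ := M c₀
  set G := boundaryChart A v f with hG
  have hGc : ContDiff ℝ ω G := h.contDiff_boundaryChart
  set z₀ : E × V × ℝ := (x₀, c₀, μ₀) with hz₀
  have hfin : Module.finrank ℝ (E × V × ℝ) = Module.finrank ℝ (E × ℝ × V) := by
    simp only [Module.finrank_prod]; ring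
  let D : (E × V × ℝ) ≃L[ℝ] (E × ℝ × V) :=
    (LinearMap.linearEquivOfInjective (fderiv ℝ G z₀ : (E × V × ℝ) →ₗ[ℝ] (E × ℝ × V))
      (h.fderiv_boundaryChart_injective hc₀ hx₀) hfin).toContinuousLinearEquiv
  have hD : HasFDerivAt G (D : (E × V × ℝ) →L[ℝ] (E × ℝ × V)) z₀ := by
    have h1 : (D : (E × V × ℝ) →L[ℝ] (E × ℝ × V)) = fderiv ℝ G z₀ := by
      exact ContinuousLinearMap.ext fun z => rfl
    rw [h1]
    exact ((hGc.differentiable (by simp)).differentiableAt).hasFDerivAt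
  have hGat : ContDiffAt ℝ ω G z₀ := hGc.contDiffAt
  have hn : (ω : WithTop ℕ∞) ≠ 0 := by simp
  have hstrict := hGat.hasStrictFDerivAt' hD hn
  set Ψ := hGat.localInverse hD hn with hΨ
  have hΨc : ContDiffAt ℝ ω Ψ (G z₀) := hGat.to_localInverse hD hn
  have hΨ0 : Ψ (G z₀) = z₀ := hGat.localInverse_apply_image hD hn
  have hright : ∀ᶠ w in 𝓝 (G z₀), G (Ψ w) = w := hstrict.eventually_right_inverse
  have hleft : ∀ᶠ z in 𝓝 z₀, Ψ (G z) = z := hstrict.eventually_left_inverse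
  set ι : V → E × ℝ × V := fun y => (0, 1, y) with hι
  have hιc : ContDiff ℝ ω ι := contDiff_const.prodMk (contDiff_const.prodMk contDiff_id)
  have hιp : ι (f x₀) = G z₀ := by
    simp [hι, hG, boundaryChart, hz₀, hx₀.eq, hx₀.norm_eq, hc₀]
  -- Inverting the chart at `(0, 1, y)` writes `y = f x + (1 - ‖c‖²) • c` with `x` a minimizer for
  -- the unnormalized `c`. Thus `y` is displaced from `f x` inwards if `‖c‖ < 1` and outwards if
  -- `‖c‖ > 1`.
  set g : V → ℝ := fun y => ‖(Ψ (ι y)).2.1‖ ^ 2 - 1 with hg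
  have hgc : ContDiffAt ℝ ω g (f x₀) := by
    have h1 : ContDiffAt ℝ ω (fun y => Ψ (ι y)) (f x₀) :=
      ContDiffAt.comp (f x₀) (hιp ▸ hΨc) hιc.contDiffAt
    exact ((h1.snd.fst).norm_sq ℝ).sub contDiffAt_const
  obtain ⟨η, hη, hinside⟩ := h.exists_forall_add_smul_mem hdim
  have hΨtend : Filter.Tendsto (fun y => Ψ (ι y)) (𝓝 (f x₀)) (𝓝 z₀) := by
    have h1 : Filter.Tendsto Ψ (𝓝 (G z₀)) (𝓝 z₀) := by
      simpa [hΨ0] using hΨc.continuousAt.tendsto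
    exact h1.comp (hιp ▸ hιc.continuous.tendsto (f x₀))
  have ev1 : ∀ᶠ y in 𝓝 (f x₀), G (Ψ (ι y)) = ι y :=
    (hιc.continuous.tendsto (f x₀)).eventually (hιp.symm ▸ hright)
  have ev2 : ∀ᶠ z in 𝓝 z₀, ∀ w, 0 ≤ ⟪A z.2.1 w, w⟫ + z.2.2 * ‖w‖ ^ 2 :=
    (continuous_snd.tendsto z₀).eventually (h.eventually_nonneg hc₀ hx₀)
  have hcn : Continuous fun z : E × V × ℝ => ‖z.2.1‖ := by fun_prop
  have ev3 : ∀ᶠ z in 𝓝 z₀, 0 < ‖z.2.1‖ :=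
    continuousAt_const.eventually_lt hcn.continuousAt (by simp [hz₀, hc₀])
  have ev4 : ∀ᶠ z in 𝓝 z₀, 1 - ‖z.2.1‖ ^ 2 < η :=
    (continuousAt_const.sub (hcn.continuousAt.pow 2)).eventually_lt continuousAt_const
      (by simp [hz₀, hc₀, hη])
  have hev := (hgc.eventually (by simp)).and (ev1.and (hΨtend.eventually (ev2.and (ev3.and ev4))))
  obtain ⟨U, hU, hUo, hpU⟩ := _root_.mem_nhds_iff.1 hev
  refine ⟨U, hUo, hpU, g, fun y hy => ((hU hy).1.of_le le_top).contDiffWithinAt, ?_, fun y hy => ?_⟩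
  · intro h0
    -- Along this curve the local inverse is explicitly `(x₀, s • c₀, s * μ₀)`, so `g (γ s) = s² -
    -- 1`, with derivative 2 at `s = 1`.
    set γ : ℝ → V := fun s => f x₀ - (s ^ 2 - 1) • s • c₀ with hγ
    have hγ1 : γ 1 = f x₀ := by simp [hγ]
    have hγd : DifferentiableAt ℝ γ 1 := by fun_prop
    have hcurve : Continuous fun s : ℝ => ((x₀, s • c₀, s * μ₀) : E × V × ℝ) := by fun_prop
    have hcurve1 : Filter.Tendsto (fun s : ℝ => ((x₀, s • c₀, s * μ₀) : E × V × ℝ)) (𝓝 1) (𝓝 z₀) := by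
      simpa [hz₀] using hcurve.tendsto 1
    have hGcurve : ∀ s : ℝ, 0 < s → G (x₀, s • c₀, s * μ₀) = ι (γ s) := by
      intro s hs
      have hs' := (hx₀.smul hs.le).eq
      simp [hG, boundaryChart, hι, hγ, hx₀.norm_eq, norm_smul, hc₀, ← hs']
    have hev2 : (fun s => g (γ s)) =ᶠ[𝓝 1] fun s => s ^ 2 - 1 := by
      filter_upwards [hcurve1.eventually hleft, lt_mem_nhds (zero_lt_one' ℝ)] with s hs hs0
      rw [hGcurve s hs0] at hs
      simp [hg, hs, norm_smul, hc₀]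
    have h1 : HasDerivAt (fun s => g (γ s)) (fderiv ℝ g (γ 1) (deriv γ 1)) 1 := by
      have h2 : HasFDerivAt g (fderiv ℝ g (γ 1)) (γ 1) := by
        rw [hγ1]
        exact (hgc.differentiableAt (by simp)).hasFDerivAt
      exact h2.comp_hasDerivAt 1 hγd.hasDerivAt
    have h2 : HasDerivAt (fun s : ℝ => s ^ 2 - 1) (2 : ℝ) 1 := by
      simpa using (hasDerivAt_pow 2 (1 : ℝ)).sub_const 1
    have h3 := h1.unique (h2.congr_of_eventuallyEq hev2)
    rw [hγ1, h0] at h3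
    norm_num at h3
  · obtain ⟨-, hy1, hnn, hpos, hτ⟩ := hU hy
    set z := Ψ (ι y) with hz
    obtain ⟨x, c, μ⟩ := z
    simp only [hG, boundaryChart, hι, Prod.mk.injEq] at hy1
    obtain ⟨e1, e2, e3⟩ := hy1
    have hxm : IsSphereMin A v c x μ := by
      refine ⟨?_, sub_eq_zero.1 e1, hnn⟩
      exact (pow_eq_one_iff_of_nonneg (norm_nonneg x) two_ne_zero).1 e2
    have hgy : g y = ‖c‖ ^ 2 - 1 := by simp only [hg, ← hz]
    have hc0 : c ≠ 0 := norm_pos_iff.1 hpos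
    rw [hgy]
    constructor
    · rintro ⟨q, hq, rfl⟩
      have h1 := h.sq_dist_le hc0 hxm (p := q) (by simpa using hq)
      have h2 : 0 ≤ ε * ‖c‖ * ‖q - x‖ ^ 2 := by have := h.pos; positivity
      rw [← e3, inner_sub_right, inner_smul_right, real_inner_self_eq_norm_sq] at h1
      by_contra! hcon
      have h3 : 0 < (‖c‖ ^ 2 - 1) * ‖c‖ ^ 2 := mul_pos hcon (pow_pos hpos 2)
      linarith
    · intro hle
      have h1 := hinside c x μ (1 - ‖c‖ ^ 2) hc0 (by nlinarith [norm_nonneg c]) hxm (by linarith)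
        hτ.le
      have h2 : y = f x + (1 - ‖c‖ ^ 2) • c := by rw [← e3]; module
      rwa [h2]

end IsGapped

end GappedQuadraticMap

/-! ### From large resolvents to the gap. -/

section GappedQuadraticMap

open Metric Set
open scoped RealInnerProductSpace

variable {V E : Type*} [NormedAddCommGroup V] [InnerProductSpace ℝ V]
  [NormedAddCommGroup E] [InnerProductSpace ℝ E]

theorem mul_norm_le_norm_add_smul {B : E →L[ℝ] E} (hB : ∀ z, 0 ≤ ⟪B z, z⟫) (t : ℝ) (z : E) :
    t * ‖z‖ ≤ ‖B z + t • z‖ := by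
  rcases eq_or_ne z 0 with rfl | hz
  · simp
  have hzp : 0 < ‖z‖ := norm_pos_iff.2 hz
  have h1 := real_inner_le_norm (B z + t • z) z
  rw [inner_add_left, inner_smul_left, real_inner_self_eq_norm_sq, conj_trivial] at h1
  have h2 := hB z
  exact le_of_mul_le_mul_right (by linarith) hzp

/-- The norm of the resolvent of a nonnegative operator takes all values between zero and a value
that it attains. -/
theorem exists_norm_eq_one_add_smul_eq [FiniteDimensional ℝ E] {B : E →L[ℝ] E}
    (hB : ∀ z, 0 ≤ ⟪B z, z⟫) {ε : ℝ} (hε : 0 < ε) {u w : E} (hu : B u + ε • u = w)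
    (hu1 : 1 < ‖u‖) : ∃ t, ε ≤ t ∧ ∃ x, ‖x‖ = 1 ∧ B x + t • x = w := by
  have hsol : ∀ t : ℝ, ε ≤ t → ∃ x, B x + t • x = w := by
    intro t ht
    have hinj : Function.Injective ((B + t • ContinuousLinearMap.id ℝ E : E →L[ℝ] E) : E →ₗ[ℝ] E) := by
      rw [injective_iff_map_eq_zero]
      intro z hz
      have h1 : B z + t • z = 0 := by simpa using hz
      have h2 := mul_norm_le_norm_add_smul hB t z
      rw [h1, norm_zero] at h2
      have h3 : ‖z‖ ≤ 0 := nonpos_of_mul_nonpos_right h2 (hε.trans_le ht)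
      exact norm_le_zero_iff.1 h3
    obtain ⟨x, hx⟩ := LinearMap.injective_iff_surjective.1 hinj w
    exact ⟨x, by simpa using hx⟩
  choose! x hx using hsol
  have hxn : ∀ t, ε ≤ t → t * ‖x t‖ ≤ ‖w‖ := fun t ht => by
    simpa [hx t ht] using mul_norm_le_norm_add_smul hB t (x t)
  have hcont : ContinuousOn x (Ici ε) := by
    refine LipschitzOnWith.continuousOn (K := (‖w‖ / ε ^ 2).toNNReal) ?_
    refine LipschitzOnWith.of_dist_le_mul fun t ht s hs => ?_
    have ht' : ε ≤ t := ht
    have hs' : ε ≤ s := hs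
    rw [Real.coe_toNNReal _ (by positivity), dist_eq_norm, Real.dist_eq]
    have h1 : B (x t - x s) + t • (x t - x s) = (s - t) • x s := by
      have h2 := (hx t ht').trans (hx s hs').symm
      have h3 : B (x t) = B (x s) + s • x s - t • x t := by rw [← h2]; abel
      rw [map_sub, h3]; module
    have h2 := mul_norm_le_norm_add_smul hB t (x t - x s)
    rw [h1, norm_smul, Real.norm_eq_abs, abs_sub_comm] at h2
    have h3 : ε * ‖x t - x s‖ ≤ |t - s| * ‖x s‖ := le_trans (by gcongr) h2
    have h4 : ε * ‖x s‖ ≤ ‖w‖ := le_trans (by gcongr) (hxn s hs')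
    rw [div_mul_eq_mul_div, le_div_iff₀ (by positivity)]
    calc ‖x t - x s‖ * ε ^ 2 = ε * (ε * ‖x t - x s‖) := by ring
      _ ≤ ε * (|t - s| * ‖x s‖) := by gcongr
      _ = |t - s| * (ε * ‖x s‖) := by ring
      _ ≤ |t - s| * ‖w‖ := by gcongr
      _ = _ := mul_comm _ _
  have hxε : x ε = u := by
    have h1 : B (x ε - u) + ε • (x ε - u) = 0 := by
      have h2 := (hx ε le_rfl).trans hu.symm
      rw [map_sub, smul_sub, ← sub_eq_zero.2 h2]; abel
    have h2 := mul_norm_le_norm_add_smul hB ε (x ε - u)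
    rw [h1, norm_zero] at h2
    exact sub_eq_zero.1 (norm_le_zero_iff.1 (nonpos_of_mul_nonpos_right h2 hε))
  -- At this parameter `R * ‖x R‖ ≤ ‖w‖ < R`, so the norm has dropped to at most 1.
  set R := ε + ‖w‖ with hR
  have hεR : ε ≤ R := by rw [hR]; linarith [norm_nonneg w]
  have hxR : ‖x R‖ ≤ 1 := by
    have h1 := hxn R hεR
    by_contra! hcon
    nlinarith [norm_nonneg w]
  obtain ⟨t, ht, ht1⟩ := intermediate_value_Icc' hεR
    (hcont.norm.mono fun t ht => ht.1) (show (1 : ℝ) ∈ Icc _ _ from ⟨hxR, by rw [hxε]; exact hu1.le⟩)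
  exact ⟨t, ht.1, x t, ht1, hx t ht.1⟩

/-- Moving the spectral parameter closer to the spectrum does not shorten the solution. -/
theorem norm_le_of_add_smul_eq {B : E →L[ℝ] E} (hB : ∀ z, 0 ≤ ⟪B z, z⟫) {ε δ : ℝ} (hε : 0 < ε)
    (hδ : 0 ≤ δ) (hδε : δ ≤ ε) {u x : E} (h : B u + ε • u = B x + δ • x) : ‖u‖ ≤ ‖x‖ := by
  set y := x - u with hy
  have h1 : B y + ε • y = (ε - δ) • x := by
    have h2 : B u = B x + δ • x - ε • u := by rw [← h]; abel
    rw [hy, map_sub, h2]; module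
  have h2 := congrArg (fun z => ⟪z, y⟫) h1
  simp only [inner_add_left, inner_smul_left, real_inner_self_eq_norm_sq, conj_trivial] at h2
  have h3 := hB y
  have h4 : u = x - y := by rw [hy]; abel
  have h5 : ‖u‖ ^ 2 = ‖x‖ ^ 2 - 2 * ⟪x, y⟫ + ‖y‖ ^ 2 := by rw [h4, norm_sub_sq_real]
  refine le_of_sq_le_sq ?_ (norm_nonneg _)
  rcases hδε.eq_or_lt with rfl | hlt
  · have h6 : δ * ‖y‖ ^ 2 ≤ 0 := by linarith
    have h7 : ‖y‖ ^ 2 ≤ 0 := nonpos_of_mul_nonpos_right h6 hε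
    have h8 : y = 0 := norm_eq_zero.1 (pow_eq_zero_iff two_ne_zero |>.1
      (le_antisymm h7 (sq_nonneg _)))
    rw [h4, h8, sub_zero]
  · have h6 : (ε - δ) * ‖y‖ ^ 2 ≤ (ε - δ) * ⟪x, y⟫ := by nlinarith [sq_nonneg ‖y‖]
    have h7 := le_of_mul_le_mul_left h6 (sub_pos.2 hlt)
    nlinarith [sq_nonneg ‖y‖]

theorem IsGapped.exists_of_resolvent [FiniteDimensional ℝ E] {A : V →L[ℝ] E →L[ℝ] E}
    {v : V →L[ℝ] E} {f : E → V} {ε : ℝ} (hε : 0 < ε)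
    (hsymm : ∀ c x y, ⟪A c x, y⟫ = ⟪x, A c y⟫)
    (hf : ∀ c x, ⟪c, f x⟫ = ⟪A c x, x⟫ - 2 * ⟪v c, x⟫)
    (hres : ∀ c, ‖c‖ = 1 → ∃ l : ℝ, (∀ z, l * ‖z‖ ^ 2 ≤ ⟪A c z, z⟫) ∧ (∃ e, e ≠ 0 ∧ A c e = l • e) ∧
      ∃ u, A c u + (ε - l) • u = v c ∧ 1 < ‖u‖) :
    ∃ X M, IsGapped A v f ε X M := by
  have hB : ∀ {c : V} {l : ℝ}, (∀ z, l * ‖z‖ ^ 2 ≤ ⟪A c z, z⟫) →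
      ∀ z, 0 ≤ ⟪(A c - l • ContinuousLinearMap.id ℝ E) z, z⟫ := by
    intro c l hl z
    have := hl z
    simp only [sub_apply, smul_apply, ContinuousLinearMap.id_apply, inner_sub_left,
      inner_smul_left, real_inner_self_eq_norm_sq, conj_trivial]
    linarith
  have hBapp : ∀ (c : V) (l t : ℝ) (z : E),
      (A c - l • ContinuousLinearMap.id ℝ E) z + t • z = A c z + (t - l) • z := by
    intro c l t z
    simp only [sub_apply, smul_apply, ContinuousLinearMap.id_apply]
    module
  have hsol : ∀ c, ‖c‖ = 1 → ∃ x μ, IsSphereMin A v c x μ := by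
    intro c hc
    obtain ⟨l, hl, -, u, hu, hu1⟩ := hres c hc
    obtain ⟨t, ht, x, hx, hxw⟩ := exists_norm_eq_one_add_smul_eq (hB hl) hε
      ((hBapp c l ε u).trans hu) hu1
    refine ⟨x, t - l, hx, by rw [← hBapp, hxw], fun z => ?_⟩
    have h1 := hl z
    nlinarith [sq_nonneg ‖z‖]
  choose! X M hXM using hsol
  refine ⟨X, M, hε, hsymm, hf, hXM, fun c x μ hc hx z => ?_⟩
  obtain ⟨l, hl, ⟨e, he, hle⟩, u, hu, hu1⟩ := hres c hc
  -- Testing nonnegativity on the lowest eigenvector bounds the shift `μ + l` below by 0. If it were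
  -- at most `ε`, monotonicity of the norm would give `‖u‖ ≤ ‖x‖ = 1`. The case `μ + l = 0`, where
  -- the operator is singular, is covered as well.
  have h1 : 0 ≤ μ + l := by
    have h2 := hx.nonneg e
    rw [hle, inner_smul_left, real_inner_self_eq_norm_sq, conj_trivial, ← add_mul] at h2
    have h3 : 0 < ‖e‖ ^ 2 := pow_pos (norm_pos_iff.2 he) 2
    linarith [nonneg_of_mul_nonneg_left h2 h3]
  have h2 : ε < μ + l := by
    by_contra! hcon
    have h3 := norm_le_of_add_smul_eq (hB hl) (u := u) (x := x) hε h1 hcon (by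
      rw [hBapp, hBapp, hu, ← hx.eq, add_sub_cancel_right])
    rw [hx.norm_eq] at h3
    linarith
  have h3 := hl z
  nlinarith [sq_nonneg ‖z‖]

end GappedQuadraticMap

/-! ### The smallest eigenvalue of a Hermitian matrix. -/

namespace QuadMap

open Metric

variable {𝕜 : Type*} [RCLike 𝕜] {m n : ℕ}

theorem dotMat_isHermitian {A : Fin m → Matrix (Fin n) (Fin n) 𝕜} (hA : ∀ i, (A i).IsHermitian)
    (c : EuclideanSpace ℝ (Fin m)) : (dotMat c A).IsHermitian := by
  rw [Matrix.IsHermitian, dotMat, Matrix.conjTranspose_sum]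
  refine Finset.sum_congr rfl fun i _ => ?_
  rw [Matrix.conjTranspose_smul, (hA i).eq, star_trivial]

/-- The smallest eigenvalue is attained and is a lower bound of the quadratic form. -/
theorem lambdaMin_spec (hn : 0 < n) {M : Matrix (Fin n) (Fin n) 𝕜} (hM : M.IsHermitian) :
    (∃ e : EuclideanSpace 𝕜 (Fin n), e ≠ 0 ∧
      Matrix.toEuclideanLin M e = ((lambdaMin M : ℝ) : 𝕜) • e) ∧
    ∀ z : EuclideanSpace 𝕜 (Fin n),
      lambdaMin M * ‖z‖ ^ 2 ≤ RCLike.re (inner 𝕜 (Matrix.toEuclideanLin M z) z) := by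
  have : Nonempty (Fin n) := ⟨⟨0, hn⟩⟩
  set T := Matrix.toEuclideanLin M with hT
  have hsymm : T.IsSymmetric := Matrix.isSymmetric_toEuclideanLin_iff.2 hM
  -- The infimum of the Rayleigh quotient is an eigenvalue and bounds the form from below, hence is
  -- the least element of the set defining `lambdaMin`.
  set r : ℝ := ⨅ x : {x : EuclideanSpace 𝕜 (Fin n) // x ≠ 0},
    RCLike.re (inner 𝕜 (T x) (x : EuclideanSpace 𝕜 (Fin n))) / ‖(x : EuclideanSpace 𝕜 (Fin n))‖ ^ 2 with hr
  have hbdd : BddBelow (Set.range fun x : {x : EuclideanSpace 𝕜 (Fin n) // x ≠ 0} =>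
      RCLike.re (inner 𝕜 (T x) (x : EuclideanSpace 𝕜 (Fin n))) /
        ‖(x : EuclideanSpace 𝕜 (Fin n))‖ ^ 2) := by
    refine ⟨-‖LinearMap.toContinuousLinearMap T‖, ?_⟩
    rintro _ ⟨⟨x, hx⟩, rfl⟩
    have hxp : 0 < ‖x‖ ^ 2 := pow_pos (norm_pos_iff.2 hx) 2
    change _ ≤ RCLike.re (inner 𝕜 (T x) x) / ‖x‖ ^ 2
    rw [le_div_iff₀ hxp]
    have h1 : |RCLike.re (inner 𝕜 (T x) x)| ≤ ‖LinearMap.toContinuousLinearMap T‖ * ‖x‖ * ‖x‖ :=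
      (RCLike.abs_re_le_norm _).trans ((norm_inner_le_norm _ _).trans (by
        gcongr; exact (LinearMap.toContinuousLinearMap T).le_opNorm x))
    linarith [(abs_le.1 h1).1]
  have hle : ∀ z : EuclideanSpace 𝕜 (Fin n), r * ‖z‖ ^ 2 ≤ RCLike.re (inner 𝕜 (T z) z) := by
    intro z
    rcases eq_or_ne z 0 with rfl | hz
    · simp
    · have h1 := ciInf_le hbdd ⟨z, hz⟩
      rwa [← hr, le_div_iff₀ (pow_pos (norm_pos_iff.2 hz) 2)] at h1
  obtain ⟨e, he⟩ := hsymm.hasEigenvalue_iInf_of_finiteDimensional.exists_hasEigenvector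
  have he1 : T e = (r : 𝕜) • e := he.apply_eq_smul
  have hleast : IsLeast {μ : ℝ | ∃ x : Fin n → 𝕜, x ≠ 0 ∧ M.mulVec x = μ • x} r := by
    constructor
    · refine ⟨WithLp.ofLp e, fun h0 => he.2 (by ext i; simpa using congrFun h0 i), ?_⟩
      have h1 := congrArg WithLp.ofLp he1
      rw [hT, Matrix.ofLp_toLpLin, Matrix.toLin'_apply] at h1
      rw [RCLike.real_smul_eq_coe_smul (K := 𝕜)]
      simpa using h1
    · rintro μ ⟨x, hx, hxμ⟩
      have hx0 : (WithLp.toLp 2 x : EuclideanSpace 𝕜 (Fin n)) ≠ 0 := fun h0 =>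
        hx (by simpa using h0)
      have h1 : T (WithLp.toLp 2 x) = (μ : 𝕜) • WithLp.toLp 2 x := by
        rw [hT, Matrix.toLpLin_toLp, Matrix.toLin'_apply, hxμ, RCLike.real_smul_eq_coe_smul (K := 𝕜), WithLp.toLp_smul]
      have h2 := hle (WithLp.toLp 2 x)
      rw [h1, inner_smul_left, RCLike.conj_ofReal, RCLike.re_ofReal_mul,
        inner_self_eq_norm_sq] at h2
      exact le_of_mul_le_mul_right h2 (pow_pos (norm_pos_iff.2 hx0) 2)
  have hlam : lambdaMin M = r := hleast.csInf_eq
  rw [hlam]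
  exact ⟨⟨e, he.2, he1⟩, hle⟩

end QuadMap

/-! ### Passage to the underlying real inner product space. -/

section RealStructure

open Metric

/-- A quadratic map on a real or complex inner product space, all of whose shifted resolvents are
large, is gapped for the underlying real inner product space. -/
theorem stronglyConvex_smooth_or_shell_of_resolvent {𝕜 E : Type*} [RCLike 𝕜]
    [NormedAddCommGroup E] [InnerProductSpace 𝕜 E] [FiniteDimensional 𝕜 E] {m : ℕ} (hm : 0 < m)
    (T : Fin m → E →ₗ[𝕜] E) (hT : ∀ i, (T i).IsSymmetric) (w : Fin m → E)
    (f : E → EuclideanSpace ℝ (Fin m))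
    (hf : ∀ x i, f x i = RCLike.re (inner 𝕜 x (T i x) - inner 𝕜 (w i) x - inner 𝕜 x (w i)))
    {ε : ℝ} (hε : 0 < ε)
    (hres : ∀ c : EuclideanSpace ℝ (Fin m), ‖c‖ = 1 → ∃ l : ℝ,
      (∀ z, l * ‖z‖ ^ 2 ≤ RCLike.re (inner 𝕜 (∑ i, ((c i : ℝ) : 𝕜) • T i z) z)) ∧
      (∃ e, e ≠ 0 ∧ ∑ i, ((c i : ℝ) : 𝕜) • T i e = (l : 𝕜) • e) ∧
      ∃ u, ∑ i, ((c i : ℝ) : 𝕜) • T i u + ((ε - l : ℝ) : 𝕜) • u = ∑ i, ((c i : ℝ) : 𝕜) • w i ∧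
        1 < ‖u‖) :
    (m < Module.finrank ℝ 𝕜 * Module.finrank 𝕜 E →
      QuadMap.StronglyConvexSet (f '' sphere 0 1) ∧ QuadMap.HasSmoothBoundary (f '' sphere 0 1)) ∧
    (m = Module.finrank ℝ 𝕜 * Module.finrank 𝕜 E →
      f '' sphere 0 1 = frontier (convexHull ℝ (f '' sphere 0 1))) := by
  let _ : InnerProductSpace ℝ E := InnerProductSpace.rclikeToReal 𝕜 E
  have hsm : ∀ (r : ℝ) (x : E), r • x = (r : 𝕜) • x := fun _ _ => rfl
  have hin : ∀ x y : E, inner ℝ x y = RCLike.re (inner 𝕜 x y) := fun _ _ => rfl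
  have : IsScalarTower ℝ 𝕜 E := ⟨fun r a x => by
    rw [hsm, ← mul_smul, RCLike.real_smul_eq_coe_mul]⟩
  have : FiniteDimensional ℝ E := FiniteDimensional.trans ℝ 𝕜 E
  have : NeZero m := ⟨hm.ne'⟩
  let A : EuclideanSpace ℝ (Fin m) →L[ℝ] E →L[ℝ] E :=
    ∑ i, (EuclideanSpace.proj i : EuclideanSpace ℝ (Fin m) →L[ℝ] ℝ).smulRight
      (LinearMap.toContinuousLinearMap ((T i).restrictScalars ℝ))
  let v : EuclideanSpace ℝ (Fin m) →L[ℝ] E :=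
    ∑ i, (EuclideanSpace.proj i : EuclideanSpace ℝ (Fin m) →L[ℝ] ℝ).smulRight (w i)
  have hA : ∀ c x, A c x = ∑ i, ((c i : ℝ) : 𝕜) • T i x := by
    intro c x
    simp only [A, sum_apply, ContinuousLinearMap.smulRight_apply, smul_apply]
    rfl
  have hv : ∀ c, v c = ∑ i, ((c i : ℝ) : 𝕜) • w i := by
    intro c
    simp only [v, sum_apply, ContinuousLinearMap.smulRight_apply]
    rfl
  obtain ⟨X, M, h⟩ := IsGapped.exists_of_resolvent (A := A) (v := v) (f := f) hε
    (by
      intro c x y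
      rw [hin, hin, hA, hA, sum_inner, inner_sum]
      congr 1
      refine Finset.sum_congr rfl fun i _ => ?_
      rw [inner_smul_left, inner_smul_right, RCLike.conj_ofReal, hT i])
    (by
      intro c x
      have h1 : (inner ℝ c (f x) : ℝ) = ∑ i, c i * f x i := by
        rw [PiLp.inner_apply]
        exact Finset.sum_congr rfl fun i _ => by simp [mul_comm]
      rw [h1, hin, hin, hA, hv, sum_inner, sum_inner, map_sum, map_sum, Finset.mul_sum,
        ← Finset.sum_sub_distrib]
      refine Finset.sum_congr rfl fun i _ => ?_
      rw [hf, inner_smul_left, inner_smul_left, RCLike.conj_ofReal, RCLike.re_ofReal_mul,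
        RCLike.re_ofReal_mul, map_sub, map_sub, inner_re_symm x (T i x), inner_re_symm x (w i)]
      ring)
    (by
      intro c hc
      obtain ⟨l, h1, ⟨e, he, h2⟩, u, h3, h4⟩ := hres c hc
      refine ⟨l, fun z => ?_, ⟨e, he, ?_⟩, u, ?_, h4⟩
      · rw [hin, hA]; exact h1 z
      · rw [hA, hsm]; exact h2
      · rw [hA, hv, hsm]; exact h3)
  have hfin : Module.finrank ℝ E = Module.finrank ℝ 𝕜 * Module.finrank 𝕜 E :=
    (Module.finrank_mul_finrank ℝ 𝕜 E).symm
  have hV : Module.finrank ℝ (EuclideanSpace ℝ (Fin m)) = m := finrank_euclideanSpace_fin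
  -- The constant `κ` is fixed by unification with `closedBall_subset_image`.
  refine ⟨fun hlt => ⟨⟨_, ?_, fun x hx y hy a b ha hb hab =>
    h.closedBall_subset_image (by rwa [hV, hfin]) hx hy ha hb hab⟩, fun p hp =>
    h.exists_smooth_defining_function (by rwa [hV, hfin]) hp⟩,
    fun heq => h.image_eq_frontier_convexHull (by rwa [hV, hfin])⟩
  positivity

end RealStructure

/-! ### The theorem for matrices. -/

/-- `𝕜` is `ℝ` or `ℂ`, so that `Module.finrank ℝ 𝕜 * n` is `n` in the real case and `2 n` in the
complex case. The limit is taken in the extended reals since it may be `+∞`. -/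
theorem proposition3 {𝕜 : Type*} [RCLike 𝕜] {m n : ℕ} (hm : 0 < m)
    (A : Fin m → Matrix (Fin n) (Fin n) 𝕜) (hA : ∀ i, (A i).IsHermitian)
    (v : Fin m → EuclideanSpace 𝕜 (Fin n))
    (L : EReal)
    (hL : Tendsto (fun ε : ℝ => ((QuadMap.minResolventNorm A v ε : ℝ) : EReal)) (𝓝[>] 0) (𝓝 L))
    (hL1 : 1 < L) :
    (m < Module.finrank ℝ 𝕜 * n →
      QuadMap.StronglyConvexSet (QuadMap.jointNumRange A v) ∧
        QuadMap.HasSmoothBoundary (QuadMap.jointNumRange A v)) ∧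
    (m = Module.finrank ℝ 𝕜 * n →
      QuadMap.jointNumRange A v = frontier (convexHull ℝ (QuadMap.jointNumRange A v))) := by
  rcases Nat.eq_zero_or_pos n with rfl | hn
  · constructor <;> intro h <;> rw [mul_zero] at h <;> omega
  -- A single `ε` at which the minimum exceeds 1 suffices.
  obtain ⟨ε, hε1, hε⟩ := ((hL.eventually (lt_mem_nhds hL1)).and self_mem_nhdsWithin).exists
  have hε0 : 0 < ε := hε
  have hmin : 1 < QuadMap.minResolventNorm A v ε := by exact_mod_cast hε1
  have hres : ∀ c : EuclideanSpace ℝ (Fin m), ‖c‖ = 1 → 1 < QuadMap.resolventNorm A v ε c := by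
    intro c hc
    refine hmin.trans_le (csInf_le ⟨0, ?_⟩ ⟨c, by simpa using hc, rfl⟩)
    rintro _ ⟨d, -, rfl⟩
    exact norm_nonneg _
  have hT : ∀ (c : EuclideanSpace ℝ (Fin m)) (z : EuclideanSpace 𝕜 (Fin n)),
      Matrix.toEuclideanLin (QuadMap.dotMat c A) z =
        ∑ i, ((c i : ℝ) : 𝕜) • Matrix.toEuclideanLin (A i) z := by
    intro c z
    simp only [QuadMap.dotMat, map_sum, LinearMap.sum_apply]
    refine Finset.sum_congr rfl fun i _ => ?_
    rw [RCLike.real_smul_eq_coe_smul (K := 𝕜), map_smul, LinearMap.smul_apply]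
  have hw : ∀ c : EuclideanSpace ℝ (Fin m), QuadMap.dotVec c v = ∑ i, ((c i : ℝ) : 𝕜) • v i := by
    intro c
    exact Finset.sum_congr rfl fun i _ => RCLike.real_smul_eq_coe_smul _ _
  have key := stronglyConvex_smooth_or_shell_of_resolvent hm
    (fun i => Matrix.toEuclideanLin (A i)) (fun i => Matrix.isSymmetric_toEuclideanLin_iff.2 (hA i))
    v (QuadMap.quadMap A v) (fun x i => rfl) hε0 (by
      intro c hc
      have hM := QuadMap.dotMat_isHermitian hA c
      obtain ⟨⟨e, he, he1⟩, hle⟩ := QuadMap.lambdaMin_spec hn hM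
      refine ⟨QuadMap.lambdaMin (QuadMap.dotMat c A), fun z => ?_, ⟨e, he, ?_⟩, ?_⟩
      · rw [← hT]; exact hle z
      · rw [← hT]; exact he1
      · have h1 := hres c hc
        rw [QuadMap.resolventNorm] at h1
        set l := QuadMap.lambdaMin (QuadMap.dotMat c A)
        set N := QuadMap.dotMat c A - l • (1 : Matrix (Fin n) (Fin n) 𝕜) +
          ε • (1 : Matrix (Fin n) (Fin n) 𝕜) with hN
        refine ⟨_, ?_, h1⟩
        -- The inverse of a singular matrix is 0 by convention, which would make the norm 0; a norm
        -- above 1 therefore already forces invertibility.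
        have hdet : IsUnit N.det := by
          by_contra hdet
          rw [Matrix.nonsing_inv_apply_not_isUnit _ hdet, map_zero, LinearMap.zero_apply,
            norm_zero] at h1
          norm_num at h1
        set u := Matrix.toEuclideanLin N⁻¹ (QuadMap.dotVec c v) with hu
        have h2 : Matrix.toEuclideanLin N u = QuadMap.dotVec c v := by
          rw [hu, Matrix.toLpLin_apply, Matrix.toLpLin_apply, Matrix.mulVec_mulVec,
            Matrix.mul_nonsing_inv _ hdet, Matrix.one_mulVec]
        rw [← hT, ← hw, ← h2, hN, RCLike.real_smul_eq_coe_smul (K := 𝕜) l,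
          RCLike.real_smul_eq_coe_smul (K := 𝕜) ε, map_add, map_sub, map_smul, map_smul,
          LinearMap.add_apply, LinearMap.sub_apply, LinearMap.smul_apply, LinearMap.smul_apply,
          Matrix.toLpLin_one, LinearMap.id_apply, RCLike.ofReal_sub]
        module)
  rwa [finrank_euclideanSpace_fin] at key
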